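/- Let $\mathbb{K}$ be a field of characteristic zero and let $n\ge 3$ be an integer. Let $\mathrm{GA}_n(\mathbb{K})$ be the group of polynomial automorphisms $\phi=((x_1)\phi,\ldots,(x_n)\phi)$ of affine $n$-space over $\mathbb{K}$, where $(P)\phi$ denotes the image of $P\in\mathbb{K}[x_1,\ldots,x_n]$ under the $\mathbb{K}$-algebra automorphism corresponding to $\phi$, and composition is such that $(P)(\phi\psi)=((P)\phi)\psi$. An automorphism is: - affine if all its components have degree one (these form the subgroup $\mathrm{Aff}_n(\mathbb{K})$), and linear (in $\mathrm{GL}_n(\mathbb{K})$) if moreover all its components have constant term zero; - triangular (in $\mathrm{BA}_n(\mathbb{K})$) if it has the form $(u_1x_1+P_1,\ldots,u_nx_n+P_n)$ with $u_i\in\mathbb{K}^*$ and $P_i\in\mathbb{K}[x_1,\ldots,x_{i-1}]$; - parabolic (in $\mathrm{PA}_n(\mathbb{K})$) if it lies in the normalizer in $\mathrm{GA}_n(\mathbb{K})$ of the group $\{(x_1,\ldots,x_{n-1},x_n+c) : c\in\mathbb{K}\}$ of translations on the last component; - co-tame if, together with $\mathrm{Aff}_n(\mathbb{K})$, it generates a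 subgroup of $\mathrm{GA}_n(\mathbb{K})$ containing the tame subgroup $\mathrm{TA}_n(\mathbb{K})=\langle \mathrm{Aff}_n(\mathbb{K}),\mathrm{BA}_n(\mathbb{K})\rangle$. Let $\psi\in\mathrm{PA}_n(\mathbb{K})$, $\tau\in\mathrm{BA}_n(\mathbb{K})$ and $\alpha\in\mathrm{GL}_n(\mathbb{K})$. Then $\psi^{-1}\alpha^{-1}\tau\alpha\psi$ is either affine or co-tame. -/

import Mathlib

open MvPolynomial

/-- The group of polynomial automorphisms of affine `n`-space over `K`. It is the opposite of the
group of `K`-algebra automorphisms of `K[x_1, …, x_n]`, so that `φ * ψ` sends a polynomial `P` to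
`((P)φ)ψ`: as polynomial maps, `φ * ψ` is `φ` after `ψ`. -/
abbrev PolyAut (K : Type*) [Field K] (n : ℕ) : Type _ :=
  (MvPolynomial (Fin n) K ≃ₐ[K] MvPolynomial (Fin n) K)ᵐᵒᵖ

namespace PolyAut

variable {K : Type*} [Field K] {n : ℕ}

/-- The image `(P)φ` of a polynomial `P` under `φ`. -/
noncomputable def act (P : MvPolynomial (Fin n) K) (φ : PolyAut K n) : MvPolynomial (Fin n) K :=
  φ.unop P

/-- The `i`-th component of `φ = ((x_1)φ, …, (x_n)φ)`. -/
noncomputable def component (φ : PolyAut K n) (i : Fin n) : MvPolynomial (Fin n) K :=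
  act (X i) φ

theorem act_mul (P : MvPolynomial (Fin n) K) (φ ψ : PolyAut K n) :
    act P (φ * ψ) = act (act P φ) ψ := rfl

/-- Affine automorphisms: all components have degree one. -/
def IsAffine (φ : PolyAut K n) : Prop :=
  ∀ i, (component φ i).totalDegree = 1

/-- Linear automorphisms: affine, and all components have constant term zero. -/
def IsLinear (φ : PolyAut K n) : Prop :=
  IsAffine φ ∧ ∀ i, constantCoeff (component φ i) = 0

/-- (Lower) triangular automorphisms: the `i`-th component is `u_i x_i + P_i` with `u_i` a unit and
`P_i` a polynomial in `x_1, …, x_{i-1}` only. -/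
def IsTriangular (φ : PolyAut K n) : Prop :=
  ∀ i, ∃ (u : Kˣ) (P : MvPolynomial (Fin n) K), P ∈ supported K (Set.Iio i) ∧
    component φ i = C (u : K) * X i + P

/-- The algebra endomorphism `x_r ↦ x_r + c`, `x_i ↦ x_i` for `i ≠ r`. -/
noncomputable def translationHom (r : Fin n) (c : K) :
    MvPolynomial (Fin n) K →ₐ[K] MvPolynomial (Fin n) K :=
  aeval (fun i => if i = r then X i + C c else X i)

theorem translationHom_comp (r : Fin n) (c d : K) (h : c + d = 0) :
    (translationHom r c).comp (translationHom r d) = AlgHom.id K _ := by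
  ext1 i
  by_cases hi : i = r
  · simp [translationHom, hi, add_assoc, ← C_add, h]
  · simp [translationHom, hi]

/-- The translation `(x_1, …, x_{r-1}, x_r + c, x_{r+1}, …, x_n)`. -/
noncomputable def translation (r : Fin n) (c : K) : PolyAut K n :=
  MulOpposite.op (AlgEquiv.ofAlgHom (translationHom r c) (translationHom r (-c))
    (translationHom_comp r c (-c) (by ring)) (translationHom_comp r (-c) c (by ring)))

theorem translationHom_add (r : Fin n) (c d : K) :
    (translationHom r c).comp (translationHom r d) = translationHom r (c + d) := by
  ext1 i
  by_cases hi : i = r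
  · simp [translationHom, hi, add_assoc]
  · simp [translationHom, hi]

theorem translationHom_zero (r : Fin n) :
    translationHom r (0 : K) = AlgHom.id K _ := by
  ext1 i
  simp [translationHom]

/-- The group of translations on the `r`-th component. -/
noncomputable def translations (K : Type*) [Field K] {n : ℕ} (r : Fin n) :
    Subgroup (PolyAut K n) where
  carrier := {φ | ∃ c : K, φ = translation r c}
  mul_mem' := by
    rintro _ _ ⟨c, rfl⟩ ⟨d, rfl⟩
    refine ⟨d + c, MulOpposite.unop_injective (AlgEquiv.ext fun P => ?_)⟩
    exact DFunLike.congr_fun (translationHom_add r d c) P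
  one_mem' := by
    refine ⟨0, MulOpposite.unop_injective (AlgEquiv.ext fun P => ?_)⟩
    exact (DFunLike.congr_fun (translationHom_zero r) P).symm
  inv_mem' := by
    rintro _ ⟨c, rfl⟩
    exact ⟨-c, MulOpposite.unop_injective (AlgEquiv.ext fun _ => rfl)⟩

/-- Parabolic automorphisms: the normalizer of the group of translations on the last component. -/
noncomputable def parabolic (K : Type*) [Field K] (n : ℕ) (hn : 1 ≤ n) :
    Subgroup (PolyAut K n) :=
  Subgroup.normalizer (translations K (⟨n - 1, by omega⟩ : Fin n) : Set (PolyAut K n))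

/-- The tame subgroup, generated by the affine and the triangular automorphisms. -/
noncomputable def tame (K : Type*) [Field K] (n : ℕ) : Subgroup (PolyAut K n) :=
  Subgroup.closure ({φ | IsAffine φ} ∪ {φ | IsTriangular φ})

/-- `φ` is co-tame if the tame subgroup is contained in the subgroup generated by `φ` and the
affine automorphisms. -/
def IsCoTame (φ : PolyAut K n) : Prop :=
  tame K n ≤ Subgroup.closure ({φ} ∪ {α | IsAffine α})

end PolyAut

/-! Over an infinite field, automorphisms can be studied as permutations of K^n. Let Γ be the group
generated by φ = ψ⁻¹α⁻¹ταψ and the affine maps. The argument splits on whether Γ is rigid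
(`IsRigid`).

If Γ is not rigid, it contains a non-affine shear x ↦ x + f(x)w
(`exists_not_isAffFun_mem_shearModule`). The factors f allowed for a given w form a vector space
stable under suitable affine substitutions, so coefficients with respect to a parameter can be
extracted. This gives squares of coordinates and then, because n ≥ 3 leaves a spare variable, every
polynomial (`eval_mem_shearModule`). Hence Γ contains all triangular maps, and φ is co-tame.

If Γ is rigid, more is true: an h in Γ that conjugates a nontrivial translation to any affine map y
↦ y + Ny + b is affine (`IsRigid.isAffMap_of_conj_translation`). Here N is nilpotent; suppose N ≠ 0.
Translations and shears commuting with the affine map pull back through h to elements of Γ commuting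
with a translation, which are affine by rigidity. This forces N to be a single Jordan block with
cyclic vector b, and likewise for a nilpotent N' attached to h⁻¹. Comparing the affine map with its
square then gives 2 = 2^((r+1)(r'+1)) with r, r' ≥ 1, a contradiction.

Finally χ = αψ carries φ to τ and, ψ being parabolic, a translation t of the last coordinate to a
translation. Iterated commutators of a triangular map with a translation reach the identity, so
those of φ with t do too. Backwards, if gtg⁻¹t⁻¹ is affine then so is gtg⁻¹, hence g; this descends
to φ (`isAffMap_or_not_isRigid`). -/

namespace PolyMap

/-! ### Polynomial and affine maps on points -/

variable {K : Type*} [Field K] {n : ℕ}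

/-- Polynomial functions on affine `n`-space. -/
def IsPolyFun (f : (Fin n → K) → K) : Prop :=
  ∃ p : MvPolynomial (Fin n) K, ∀ x, f x = eval x p

/-- Affine maps of affine `n`-space. -/
def IsAffMap (f : (Fin n → K) → (Fin n → K)) : Prop :=
  ∃ (A : (Fin n → K) →ₗ[K] (Fin n → K)) (b : Fin n → K), ∀ x, f x = A x + b

/-- Groups of polynomial automorphisms which contain all affine ones, as groups of
permutations of affine `n`-space. -/
structure IsOverAffine (Γ : Subgroup (Equiv.Perm (Fin n → K))) : Prop where
  poly : ∀ h ∈ Γ, ∀ i, IsPolyFun (fun x => h x i)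
  aff : ∀ h : Equiv.Perm (Fin n → K), IsAffMap h → h ∈ Γ

/-- The degree bound is uniform over all lines, so that one iterate of `fwdDiff v` kills `f`
everywhere. -/
theorem IsPolyFun.exists_line {f : (Fin n → K) → K} (hf : IsPolyFun f) :
    ∃ D : ℕ, ∀ y v : Fin n → K, ∃ p : Polynomial K, p.natDegree ≤ D ∧
      ∀ c : K, f (y + c • v) = p.eval c := by
  obtain ⟨F, hF⟩ := hf
  refine ⟨F.totalDegree, fun y v =>
    ⟨aeval (fun i => Polynomial.C (y i) + Polynomial.X * Polynomial.C (v i)) F, ?_, ?_⟩⟩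
  · refine (MvPolynomial.aeval_natDegree_le F (le_refl _) _ (n := 1) (fun i => ?_)).trans (by simp)
    compute_degree
  · intro c
    rw [hF, ← Polynomial.coe_aeval_eq_eval]
    rw [← AlgHom.comp_apply, MvPolynomial.comp_aeval]
    rw [← MvPolynomial.coe_aeval_eq_eval]
    simp only [RingHom.coe_coe]
    congr 2
    funext i
    simp
    ring

/-- The base point stays in the coefficient ring `W → K` and only `c` is a variable, the form that
`mem_of_infinite_eval_mem` needs. -/
theorem IsPolyFun.exists_family {f : (Fin n → K) → K} (hf : IsPolyFun f) {W : Type*}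
    (y z : W → Fin n → K) :
    ∃ P : Polynomial (W → K), ∀ (c : K) (x : W),
      f (y x + c • z x) = P.eval (fun _ => c) x := by
  obtain ⟨F, hF⟩ := hf
  refine ⟨aeval (fun i => Polynomial.C (fun x => y x i) + Polynomial.X *
    Polynomial.C (fun x => z x i)) F, fun c x => ?_⟩
  rw [hF]
  let φ : Polynomial (W → K) →ₐ[K] K :=
    (Pi.evalAlgHom K (fun _ : W => K) x).comp
      ((Polynomial.aeval (R := W → K) (A := W → K) (fun _ => c)).restrictScalars K)
  have h1 : ∀ Q : Polynomial (W → K), Q.eval (fun _ => c) x = φ Q := fun Q => by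
    simp [φ, Polynomial.coe_aeval_eq_eval]
  rw [h1, ← AlgHom.comp_apply, MvPolynomial.comp_aeval, ← MvPolynomial.coe_aeval_eq_eval]
  simp only [RingHom.coe_coe]
  congr 2
  funext i
  rw [← h1]
  simp
  ring

theorem IsPolyFun.add {f g : (Fin n → K) → K} (hf : IsPolyFun f) (hg : IsPolyFun g) :
    IsPolyFun (fun x => f x + g x) := by
  obtain ⟨p, hp⟩ := hf
  obtain ⟨q, hq⟩ := hg
  exact ⟨p + q, fun x => by simp [hp, hq]⟩

theorem IsPolyFun.mul {f g : (Fin n → K) → K} (hf : IsPolyFun f) (hg : IsPolyFun g) :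
    IsPolyFun (fun x => f x * g x) := by
  obtain ⟨p, hp⟩ := hf
  obtain ⟨q, hq⟩ := hg
  exact ⟨p * q, fun x => by simp [hp, hq]⟩

theorem IsPolyFun.const (c : K) : IsPolyFun (fun _ : Fin n → K => c) :=
  ⟨C c, fun x => by simp⟩

theorem IsPolyFun.coord (i : Fin n) : IsPolyFun (fun x : Fin n → K => x i) :=
  ⟨X i, fun x => by simp⟩

theorem IsPolyFun.sub {f g : (Fin n → K) → K} (hf : IsPolyFun f) (hg : IsPolyFun g) :
    IsPolyFun (fun x => f x - g x) := by
  obtain ⟨p, hp⟩ := hf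
  obtain ⟨q, hq⟩ := hg
  exact ⟨p - q, fun x => by simp [hp, hq]⟩

theorem IsPolyFun.sum {ι : Type*} (s : Finset ι) {f : ι → (Fin n → K) → K}
    (hf : ∀ i ∈ s, IsPolyFun (f i)) : IsPolyFun (fun x => ∑ i ∈ s, f i x) := by
  choose! p hp using hf
  exact ⟨∑ i ∈ s, p i, fun x => by
    rw [map_sum]; exact Finset.sum_congr rfl fun i hi => hp i hi x⟩

theorem IsPolyFun.comp {f : (Fin n → K) → K} (hf : IsPolyFun f)
    {g : (Fin n → K) → (Fin n → K)} (hg : ∀ i, IsPolyFun (fun x => g x i)) :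
    IsPolyFun (fun x => f (g x)) := by
  obtain ⟨p, hp⟩ := hf
  choose q hq using hg
  refine ⟨bind₁ q p, fun x => ?_⟩
  change f (g x) = _
  rw [hp]
  have : g x = fun i => eval x (q i) := funext fun i => hq i x
  rw [this, ← MvPolynomial.coe_aeval_eq_eval, ← MvPolynomial.coe_aeval_eq_eval]
  simp only [RingHom.coe_coe]
  rw [MvPolynomial.aeval_bind₁]

theorem IsPolyFun.linear (l : (Fin n → K) →ₗ[K] K) : IsPolyFun (fun x => l x) := by
  have : (fun x => l x) = fun x : Fin n → K => ∑ i, x i * l (Pi.single i 1) := by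
    funext x
    conv_lhs => rw [LinearMap.pi_apply_eq_sum_univ l x]
    refine Finset.sum_congr rfl fun i _ => ?_
    rw [smul_eq_mul]
    congr 2
    funext j
    simp [Pi.single_apply, eq_comm]
  rw [this]
  exact IsPolyFun.sum _ fun i _ => (IsPolyFun.coord i).mul (IsPolyFun.const _)

theorem IsPolyFun.linear_comp (l : (Fin n → K) →ₗ[K] K) {g : (Fin n → K) → (Fin n → K)}
    (hg : ∀ i, IsPolyFun (fun x => g x i)) : IsPolyFun (fun x => l (g x)) :=
  (IsPolyFun.linear l).comp hg

theorem IsAffMap.isPolyFun {f : (Fin n → K) → (Fin n → K)} (hf : IsAffMap f) (i : Fin n) :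
    IsPolyFun (fun x => f x i) := by
  obtain ⟨A, b, h⟩ := hf
  simp only [h]
  exact (IsPolyFun.linear ((LinearMap.proj i).comp A)).add (IsPolyFun.const (b i))

theorem IsAffMap.comp {f g : (Fin n → K) → (Fin n → K)} (hf : IsAffMap f) (hg : IsAffMap g) :
    IsAffMap (fun x => f (g x)) := by
  obtain ⟨A, b, h⟩ := hf
  obtain ⟨A', b', h'⟩ := hg
  exact ⟨A.comp A', A b' + b, fun x => by simp [h, h', add_assoc]⟩

theorem IsAffMap.symm {f : Equiv.Perm (Fin n → K)} (hf : IsAffMap f) :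
    IsAffMap (f⁻¹ : Equiv.Perm (Fin n → K)) := by
  obtain ⟨A, b, h⟩ := hf
  have hA : Function.Bijective A := by
    have : (A : (Fin n → K) → (Fin n → K)) = (Equiv.subRight b) ∘ f := by
      funext x; simp [h]
    rw [this]
    exact (Equiv.subRight b).bijective.comp f.bijective
  let e := LinearEquiv.ofBijective A hA
  refine ⟨e.symm, - e.symm b, fun x => ?_⟩
  rw [Equiv.Perm.inv_eq_iff_eq, h]
  change x = e (e.symm x + -e.symm b) + b
  simp

theorem IsAffMap.translation (v : Fin n → K) : IsAffMap (Equiv.addRight v) :=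
  ⟨LinearMap.id, v, fun x => by simp⟩

/-- A polynomial identity along a line which holds at all natural numbers holds everywhere. -/
theorem IsPolyFun.line_eq_of_nat [CharZero K] {f : (Fin n → K) → K} (hf : IsPolyFun f)
    (y v : Fin n → K) (q : Polynomial K) (h : ∀ m : ℕ, f (y + (m : K) • v) = q.eval (m : K))
    (c : K) : f (y + c • v) = q.eval c := by
  obtain ⟨D, hD⟩ := hf.exists_line
  obtain ⟨p, -, hp⟩ := hD y v
  have : p = q := Polynomial.eq_of_infinite_eval_eq p q <|
    (Set.infinite_range_of_injective (Nat.cast_injective (R := K))).mono <| by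
      rintro _ ⟨m, rfl⟩
      simp [← hp, h]
  rw [hp, this]

theorem line_eq_of_nat [CharZero K] {h : (Fin n → K) → (Fin n → K)}
    (hp : ∀ i, IsPolyFun (fun x => h x i)) {v w : Fin n → K} (hh : ∀ x, h (x + v) = h x + w)
    (c : K) (x : Fin n → K) : h (x + c • v) = h x + c • w := by
  have hm : ∀ m : ℕ, h (x + (m : K) • v) = h x + (m : K) • w := by
    intro m
    induction m with
    | zero => simp
    | succ k ih =>
      push_cast
      rw [add_smul, one_smul, ← add_assoc, hh, ih, add_smul, one_smul, add_assoc]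
  funext i
  have := (hp i).line_eq_of_nat x v (Polynomial.C (h x i) + Polynomial.C (w i) * Polynomial.X)
    (fun m => by simp [hm]; ring) c
  rw [this]
  simp
  ring

theorem IsPolyFun.iterate_fwdDiff_eq_zero {f : (Fin n → K) → K} (hf : IsPolyFun f)
    (v : Fin n → K) : ∃ k, (fwdDiff v)^[k] f = 0 := by
  obtain ⟨D, hD⟩ := hf.exists_line
  refine ⟨D + 1, funext fun y => ?_⟩
  obtain ⟨p, hp, hpe⟩ := hD y v
  have := congrFun (Polynomial.fwdDiff_iter_eq_zero_of_degree_lt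
    (P := p) (n := D + 1) (by omega)) 0
  rw [fwdDiff_iter_eq_sum_shift] at this ⊢
  simp only [Pi.zero_apply] at this ⊢
  rw [← this]
  refine Finset.sum_congr rfl fun j _ => ?_
  congr 1
  have h2 := hpe (j : K)
  rw [Nat.cast_smul_eq_nsmul] at h2
  simpa using h2

/-- Otherwise a functional vanishing on `M` but not on the coefficient would turn `P` into a nonzero
scalar polynomial with infinitely many roots. -/
theorem mem_of_infinite_eval_mem {W : Type*} (M : Submodule K (W → K)) (P : Polynomial (W → K))
    {S : Set K} (hS : S.Infinite) (h : ∀ c ∈ S, P.eval (fun _ => c) ∈ M) (k : ℕ) :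
    P.coeff k ∈ M := by
  by_contra hk
  obtain ⟨φ, hφ, hφM⟩ := Submodule.exists_le_ker_of_notMem hk
  let q : Polynomial K := ∑ i ∈ Finset.range (P.natDegree + 1),
    Polynomial.monomial i (φ (P.coeff i))
  have hq : q = 0 := by
    refine Polynomial.eq_zero_of_infinite_isRoot q (hS.mono fun c hc => ?_)
    have h1 : φ (P.eval (fun _ => c)) = 0 := hφM (h c hc)
    rw [Polynomial.eval_eq_sum_range, map_sum] at h1
    simp only [Set.mem_ofPred_eq, Polynomial.IsRoot.def, q, Polynomial.eval_finsetSum,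
      Polynomial.eval_monomial]
    rw [← h1]
    refine Finset.sum_congr rfl fun i _ => ?_
    have : P.coeff i * (fun _ => c) ^ i = (c ^ i) • P.coeff i := by
      funext x; simp [mul_comm]
    rw [this, map_smul, smul_eq_mul, mul_comm]
  apply hφ
  by_cases hkd : k ≤ P.natDegree
  · have : q.coeff k = φ (P.coeff k) := by
      simp only [q, Polynomial.finsetSum_coeff, Polynomial.coeff_monomial]
      rw [Finset.sum_ite_eq' ]
      simp [Nat.lt_succ_of_le hkd]
    rw [← this, hq, Polynomial.coeff_zero]
  · rw [Polynomial.coeff_eq_zero_of_natDegree_lt (by omega), map_zero]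

end PolyMap

/-! ### Rigid groups: translations conjugated to affine maps -/

namespace PolyMap

variable {K : Type*} [Field K] {n : ℕ}

/-- Every element which conjugates some nontrivial translation to a translation is affine. -/
def IsRigid (Γ : Subgroup (Equiv.Perm (Fin n → K))) : Prop :=
  ∀ h ∈ Γ, ∀ v w : Fin n → K, v ≠ 0 → (∀ x, h (x + v) = h x + w) → IsAffMap h

theorem perm_apply_inv_self {α : Type*} (h : Equiv.Perm α) (x : α) : h (h⁻¹ x) = x :=
  h.apply_symm_apply x

theorem perm_inv_apply_self {α : Type*} (h : Equiv.Perm α) (x : α) : h⁻¹ (h x) = x :=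
  h.symm_apply_apply x

theorem iterate_fwdDiff_linear_comp {h : (Fin n → K) → (Fin n → K)} {v b : Fin n → K}
    {N : Module.End K (Fin n → K)} (hN : ∀ x, h (x + v) = h x + (N (h x) + b))
    (l : (Fin n → K) →ₗ[K] K) (k : ℕ) (x : Fin n → K) :
    (fwdDiff v)^[k + 1] (fun x => l (h x)) x = l ((N ^ k) (N (h x) + b)) := by
  induction k generalizing x with
  | zero => simp [fwdDiff, hN]
  | succ k ih =>
    rw [Function.iterate_succ_apply', fwdDiff, ih, ih, ← map_sub, ← map_sub, hN]
    congr 1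
    rw [pow_succ, Module.End.mul_apply]
    congr 1
    simp

/-- High differences of `h` along `v` vanish, while the (k+1)-st is N^k(Nh + b). By surjectivity
N^m(Ny + b) = 0 for all y; subtracting the case y = 0 leaves N^(m+1) = 0. -/
theorem isNilpotent_of_conj_translation {h : (Fin n → K) → (Fin n → K)}
    (hp : ∀ i, IsPolyFun (fun x => h x i)) (hs : Function.Surjective h) {v b : Fin n → K}
    {N : Module.End K (Fin n → K)} (hN : ∀ x, h (x + v) = h x + (N (h x) + b)) :
    IsNilpotent N := by
  have h1 : ∀ i, ∃ k, (fwdDiff v)^[k] (fun x => h x i) = 0 := fun i =>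
    (hp i).iterate_fwdDiff_eq_zero v
  choose k hk using h1
  let m := Finset.univ.sup k
  have h2 : ∀ y, (N ^ m) (N y + b) = 0 := by
    intro y
    obtain ⟨x, rfl⟩ := hs y
    funext i
    have h3 := iterate_fwdDiff_linear_comp hN (LinearMap.proj i) m x
    simp only [LinearMap.proj_apply] at h3
    rw [← h3]
    have h4 : m + 1 = (m + 1 - k i) + k i := by
      have : k i ≤ m := Finset.le_sup (Finset.mem_univ i)
      omega
    rw [h4, Function.iterate_add_apply, hk i]
    have : ∀ j, (fwdDiff v)^[j] (0 : (Fin n → K) → K) = 0 := by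
      intro j
      induction j with
      | zero => rfl
      | succ j ih => rw [Function.iterate_succ_apply', ih]; funext x; simp [fwdDiff]
    rw [this]; rfl
  refine ⟨m + 1, LinearMap.ext fun y => ?_⟩
  have h5 := h2 y
  have h6 := h2 0
  rw [map_zero, zero_add] at h6
  rw [map_add, h6, add_zero] at h5
  rw [pow_succ, Module.End.mul_apply, h5, LinearMap.zero_apply]

/-- A nontrivial translation has no fixed point, hence neither has its conjugate y ↦ y + Ny + b. -/
theorem notMem_range_of_conj_translation {h : (Fin n → K) → (Fin n → K)}
    (hh : Function.Bijective h) {v b : Fin n → K} (hv : v ≠ 0)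
    {N : Module.End K (Fin n → K)} (hN : ∀ x, h (x + v) = h x + (N (h x) + b)) :
    b ∉ LinearMap.range N := by
  rintro ⟨y, rfl⟩
  obtain ⟨x, hx⟩ := hh.2 (-y)
  have := hN x
  rw [hx, map_neg, neg_add_cancel, add_zero, ← hx] at this
  exact hv (by simpa using hh.1 this)

theorem exists_pow_ne_zero_of_isNilpotent {V : Type*} [AddCommGroup V] [Module K V]
    {N : Module.End K V} (hN : IsNilpotent N) (h0 : N ≠ 0) :
    ∃ r, N ^ (r + 1) ≠ 0 ∧ N ^ (r + 2) = 0 := by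
  classical
  have hm := Nat.find_spec hN
  have hlt := fun j => Nat.find_min hN (m := j)
  obtain hc | hc | ⟨r, hr⟩ : Nat.find hN = 0 ∨ Nat.find hN = 1 ∨ ∃ r, Nat.find hN = r + 2 := by
    rcases Nat.find hN with _ | _ | r <;> simp
  · rw [hc, pow_zero] at hm
    exact absurd (by rw [← mul_one N, hm, mul_zero]) h0
  · rw [hc, pow_one] at hm
    exact absurd hm h0
  · exact ⟨r, hlt _ (by omega), hr ▸ hm⟩

theorem exists_functional {V : Type*} [AddCommGroup V] [Module K V] {S : Submodule K V} {b : V}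
    (hb : b ∉ S) : ∃ s : V →ₗ[K] K, s b = 1 ∧ ∀ x ∈ S, s x = 0 := by
  obtain ⟨φ, h1, h2⟩ := Submodule.exists_le_ker_of_notMem hb
  refine ⟨(φ b)⁻¹ • φ, by simp [h1], fun x hx => ?_⟩
  have : φ x = 0 := h2 hx
  simp [this]

theorem linear_functional_mul_eq_zero {V : Type*} [AddCommGroup V] [Module K V]
    {μ ν : V →ₗ[K] K} (h : ∀ x, μ x * ν x = 0) : μ = 0 ∨ ν = 0 := by
  by_contra! hc
  obtain ⟨x, hx⟩ := DFunLike.ne_iff.1 hc.1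
  obtain ⟨y, hy⟩ := DFunLike.ne_iff.1 hc.2
  simp only [LinearMap.zero_apply] at hx hy
  have h1 : ν x = 0 := (mul_eq_zero.1 (h x)).resolve_left hx
  have h2 : μ y = 0 := (mul_eq_zero.1 (h y)).resolve_right hy
  have := h (x + y)
  simp [h1, h2, hx, hy] at this

section Rigid

variable {Γ : Subgroup (Equiv.Perm (Fin n → K))} {h : Equiv.Perm (Fin n → K)}
  {v b : Fin n → K} {N : Module.End K (Fin n → K)}

/-- Since N v₁ = 0, translation by v₁ commutes with y ↦ y + Ny + b, so its conjugate by h⁻¹ commutes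
with translation by v and is affine by rigidity. If N' were 0, rigidity would make h affine, forcing
N = 0. -/
theorem IsRigid.exists_conj_translation (hR : IsRigid Γ) (hΓ : IsOverAffine Γ) (hh : h ∈ Γ)
    (hv : v ≠ 0) (hN : ∀ x, h (x + v) = h x + (N (h x) + b)) (hN0 : N ≠ 0) {v₁ : Fin n → K}
    (hv₁ : v₁ ≠ 0) (hNv₁ : N v₁ = 0) :
    ∃ (N' : Module.End K (Fin n → K)) (b' : Fin n → K),
      (∀ y, h⁻¹ (y + v₁) = h⁻¹ y + (N' (h⁻¹ y) + b')) ∧ N' ≠ 0 ∧ N' v = 0 := by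
  have hmem : h⁻¹ * Equiv.addRight v₁ * h ∈ Γ :=
    mul_mem (mul_mem (inv_mem hh) (hΓ.aff _ (IsAffMap.translation v₁))) hh
  have hcomm : ∀ x, (h⁻¹ * Equiv.addRight v₁ * h) (x + v) =
      (h⁻¹ * Equiv.addRight v₁ * h) x + v := by
    intro x
    simp only [Equiv.Perm.mul_apply, Equiv.coe_addRight]
    rw [Equiv.Perm.inv_eq_iff_eq, hN, hN, perm_apply_inv_self, map_add, hNv₁]
    abel
  obtain ⟨A, b', hA⟩ := hR _ hmem v v hv hcomm
  have hA' : ∀ y, h⁻¹ (y + v₁) = A (h⁻¹ y) + b' := by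
    intro y
    rw [← hA]
    simp
  refine ⟨A - 1, b', fun y => ?_, fun h0 => ?_, ?_⟩
  · rw [hA', LinearMap.sub_apply, Module.End.one_apply]
    abel
  · rw [sub_eq_zero] at h0
    have haff : IsAffMap (h⁻¹ : Equiv.Perm (Fin n → K)) :=
      hR _ (inv_mem hh) v₁ b' hv₁ fun y => by rw [hA', h0, Module.End.one_apply]
    have haff' := haff.symm
    rw [inv_inv] at haff'
    obtain ⟨B, d, hB⟩ := haff'
    apply hN0
    have h1 : ∀ y, N y + b = B v := fun y => by
      have := hN (h⁻¹ y)
      rw [hB (h⁻¹ y + v), map_add, perm_apply_inv_self] at this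
      have h2 := hB (h⁻¹ y)
      rw [perm_apply_inv_self] at h2
      have h3 : y + (N y + b) = y + B v := by
        rw [← this]
        nth_rewrite 2 [h2]
        abel
      exact add_left_cancel h3
    refine LinearMap.ext fun y => ?_
    have h4 := h1 y
    rw [← h1 0, map_zero] at h4
    simpa using h4
  · have h1 := hcomm 0
    rw [hA, hA, map_add, map_zero] at h1
    rw [LinearMap.sub_apply, Module.End.one_apply]
    have : A v = v := by
      rw [zero_add] at h1
      exact add_right_cancel (h1.trans (by abel))
    rw [this, sub_self]

/-- Otherwise some functional l ≠ 0 kills range N and b, and a shear with factor l commutes with the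
affine map, so its pullback through h is affine. Read through functionals adapted to N', this makes
l ∘ h affine and then makes a product of two nonzero linear forms vanish. -/
theorem IsRigid.range_sup_span_eq_top [CharZero K] (hR : IsRigid Γ) (hΓ : IsOverAffine Γ)
    (hh : h ∈ Γ) (hv : v ≠ 0) (hN : ∀ x, h (x + v) = h x + (N (h x) + b)) (hN0 : N ≠ 0) :
    LinearMap.range N ⊔ Submodule.span K {b} = ⊤ := by
  by_contra htop
  obtain ⟨y₀, hy₀⟩ : ∃ y, y ∉ LinearMap.range N ⊔ Submodule.span K {b} := by
    by_contra! hc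
    exact htop (eq_top_iff.2 fun y _ => hc y)
  obtain ⟨l, hl1, hl⟩ := exists_functional hy₀
  have hlN : ∀ x, l (N x) = 0 := fun x => hl _ (Submodule.mem_sup_left ⟨x, rfl⟩)
  have hlb : l b = 0 := hl _ (Submodule.mem_sup_right (Submodule.mem_span_singleton_self b))
  obtain ⟨r, hr1, hr2⟩ := exists_pow_ne_zero_of_isNilpotent
    (isNilpotent_of_conj_translation (hΓ.poly h hh) h.surjective hN) hN0
  obtain ⟨z, hz⟩ := DFunLike.ne_iff.1 hr1
  set v₁ := (N ^ (r + 1)) z with hv₁def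
  have hv₁ : v₁ ≠ 0 := hz
  have hNv₁ : N v₁ = 0 := by
    rw [hv₁def, ← Module.End.mul_apply, ← pow_succ', hr2, LinearMap.zero_apply]
  have hlv₁ : l v₁ = 0 := by rw [hv₁def, pow_succ', Module.End.mul_apply, hlN]
  obtain ⟨N', b', hN', hN'0, hN'v⟩ := hR.exists_conj_translation hΓ hh hv hN hN0 hv₁ hNv₁
  have hpi := hΓ.poly _ (inv_mem hh)
  -- functionals adapted to the nilpotent `N'`
  obtain ⟨s, hs1, hs⟩ := exists_functional
    (notMem_range_of_conj_translation (h⁻¹ : Equiv.Perm (Fin n → K)).bijective hv₁ hN')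
  have hsN : ∀ x, s (N' x) = 0 := fun x => hs _ ⟨x, rfl⟩
  obtain ⟨r', hr1', hr2'⟩ := exists_pow_ne_zero_of_isNilpotent
    (isNilpotent_of_conj_translation hpi (h⁻¹ : Equiv.Perm (Fin n → K)).surjective hN') hN'0
  obtain ⟨z', hz'⟩ := DFunLike.ne_iff.1 hr1'
  obtain ⟨i, hi⟩ := Function.ne_iff.1 hz'
  -- `f` is a coordinate of the last nonzero power of N'. Along c ↦ h⁻¹(hx + c v₁), `s` and `f` vary
  -- with degree at most one in c, and `t` with degree at most two.
  let t : (Fin n → K) →ₗ[K] K := (LinearMap.proj i).comp (N' ^ r')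
  let f : (Fin n → K) →ₗ[K] K := t.comp N'
  have hf0 : f ≠ 0 := fun h0 => hi (by
    have := LinearMap.congr_fun h0 z'
    simpa [f, t, ← Module.End.mul_apply, ← pow_succ] using this)
  have hfN : ∀ x, f (N' x) = 0 := fun x => by
    simp only [f, t, LinearMap.comp_apply, ← Module.End.mul_apply, LinearMap.proj_apply]
    rw [← sq, ← pow_add, hr2']
    rfl
  have hft : ∀ x, t (N' x) = f x := fun x => rfl
  -- the shear along `v₁` with factor `l`
  let β : Equiv.Perm (Fin n → K) :=
    ⟨fun y => y + l y • v₁, fun y => y - l y • v₁, fun y => by simp [hlv₁],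
      fun y => by simp [hlv₁]⟩
  have hβ : IsAffMap β := ⟨LinearMap.id + l.smulRight v₁, 0, fun y => by simp [β]⟩
  have hγmem : h⁻¹ * β * h ∈ Γ := mul_mem (mul_mem (inv_mem hh) (hΓ.aff _ hβ)) hh
  obtain ⟨G, d, hG⟩ := hR (h⁻¹ * β * h) hγmem v v hv (fun x => by
    simp only [Equiv.Perm.mul_apply]
    rw [Equiv.Perm.inv_eq_iff_eq, hN, hN, perm_apply_inv_self]
    simp only [β, Equiv.coe_fn_mk, map_add, map_smul, hNv₁, hlN, hlb]
    simp
    abel)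
  have hG' : ∀ x, h⁻¹ (h x + l (h x) • v₁) = G x + d := fun x => by rw [← hG]; rfl
  -- evaluation of functionals along the orbits
  have hsline : ∀ x c, s (h⁻¹ (h x + c • v₁)) = s x + c := by
    intro x c
    have := (IsPolyFun.linear_comp s hpi).line_eq_of_nat (h x) v₁
      (Polynomial.C (s x) + Polynomial.X) (fun m => by
        induction m with
        | zero => simp
        | succ m ih =>
          push_cast
          rw [add_smul, one_smul, ← add_assoc, hN', map_add s, map_add s, hsN, hs1, ih]
          simp
          ring) c
    rw [this]; simp
  have hfline : ∀ x (m : ℕ), f (h⁻¹ (h x + (m : K) • v₁)) = f x + m * f b' := by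
    intro x m
    induction m with
    | zero => simp
    | succ m ih =>
      push_cast
      rw [add_smul, one_smul, ← add_assoc, hN', map_add f, map_add f, hfN, ih]
      ring
  have htline : ∀ x c, t (h⁻¹ (h x + c • v₁)) =
      t x + c * (f x + t b') + c * (c - 1) / 2 * f b' := by
    intro x c
    have := (IsPolyFun.linear_comp t hpi).line_eq_of_nat (h x) v₁
      (Polynomial.C (t x) + Polynomial.X * Polynomial.C (f x + t b') +
        Polynomial.X * (Polynomial.X - Polynomial.C 1) * Polynomial.C (f b' / 2)) (fun m => by
        induction m with
        | zero => simp
        | succ m ih =>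
          push_cast
          rw [add_smul, one_smul, ← add_assoc, hN', map_add t, map_add t, hft, hfline, ih]
          simp
          ring) c
    rw [this]; simp; ring
  -- `l ∘ h` is affine
  let μ : (Fin n → K) →ₗ[K] K := s.comp G - s
  have hm : ∀ x, l (h x) = μ x + s d := by
    intro x
    have h1 := hsline x (l (h x))
    rw [hG', map_add] at h1
    simp only [μ, LinearMap.sub_apply, LinearMap.comp_apply]
    linear_combination -h1
  have hμ0 : μ ≠ 0 := by
    intro h0
    have h1 := hm (h⁻¹ y₀)
    have h2 := hm (h⁻¹ 0)
    rw [h0, perm_apply_inv_self] at h1 h2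
    simp [hl1] at h1 h2
    exact one_ne_zero (h1.trans h2.symm)
  have hμb : μ b' = 0 := by
    have h1 := hm (h⁻¹ (h 0 + v₁))
    rw [perm_apply_inv_self, map_add, hlv₁, hm, hN'] at h1
    simpa using h1.symm
  have hquad : ∀ x, μ x * (f + (f b' / 2) • μ) x = 0 := by
    intro x
    have key : ∀ x, t (G x) + t d = t x + (μ x + s d) * (f x + t b') +
        (μ x + s d) * ((μ x + s d) - 1) / 2 * f b' := by
      intro x
      rw [← hm, ← htline, hG', map_add]
    have h1 := key x
    have h2 := key (-x)
    have h3 := key 0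
    simp only [map_neg, map_zero] at h2 h3
    simp only [LinearMap.add_apply, LinearMap.smul_apply, smul_eq_mul]
    -- The second difference over x, 0, -x removes the affine terms and leaves the quadratic part.
    have h4 : 2 * (μ x * (f x + f b' / 2 * μ x)) = 0 := by
      linear_combination -h1 - h2 + 2 * h3
    simpa using h4
  rcases linear_functional_mul_eq_zero hquad with h0 | h0
  · exact hμ0 h0
  -- Now `f` is a multiple of `μ`; since μ b' = 0, also f b' = 0, which is the multiplier up to a
  -- factor.
  · have h1 := LinearMap.congr_fun h0 b'
    simp [hμb] at h1
    rw [h1] at h0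
    simp at h0
    exact hf0 h0

end Rigid

end PolyMap

/-! ### Cyclic nilpotent maps and powers of affine maps -/

namespace PolyMap

section Cyclic

variable {K V : Type*} [Field K] [AddCommGroup V] [Module K V] {N : Module.End K V} {b : V}

theorem linearIndependent_pow_apply {r : ℕ} (h1 : (N ^ r) b ≠ 0) (h2 : (N ^ (r + 1)) b = 0) :
    LinearIndependent K (fun j : Fin (r + 1) => (N ^ (j : ℕ)) b) := by
  rw [Fintype.linearIndependent_iff]
  intro g hg
  have h3 : ∀ k, r < k → (N ^ k) b = 0 := fun k hk => by
    obtain ⟨m, rfl⟩ := Nat.exists_eq_add_of_lt hk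
    rw [show r + m + 1 = m + (r + 1) by ring, pow_add, Module.End.mul_apply, h2, map_zero]
  have key : ∀ (m : ℕ) (j : Fin (r + 1)), (j : ℕ) = m → g j = 0 := by
    intro m
    induction m using Nat.strong_induction_on with
    | _ m ih =>
      intro j hj
      -- N^(r-m) kills the terms of index above m, and those below vanish by induction.
      have h4 := congrArg (N ^ (r - m)) hg
      rw [map_sum, map_zero, Finset.sum_eq_single j] at h4
      · rw [map_smul, ← Module.End.mul_apply, ← pow_add, hj,
          Nat.sub_add_cancel (by omega)] at h4
        exact (smul_eq_zero.1 h4).resolve_right h1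
      · intro i _ hij
        have hij' : (i : ℕ) ≠ m := fun h => hij (Fin.ext (h.trans hj.symm))
        rcases lt_or_gt_of_ne hij' with h5 | h5
        · rw [ih i h5 i rfl, zero_smul, map_zero]
        · rw [map_smul, ← Module.End.mul_apply, ← pow_add, h3 _ (by omega), smul_zero]
      · simp
  exact fun j => key j j rfl

/-- Substituting V = range N + ⟨b⟩ into itself k times gives V = S + range N^k, and nilpotency
removes the last term. -/
theorem span_pow_apply_eq_top {r : ℕ} (hN : IsNilpotent N)
    (htop : LinearMap.range N ⊔ Submodule.span K {b} = ⊤) (h2 : (N ^ (r + 1)) b = 0) :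
    Submodule.span K (Set.range fun j : Fin (r + 1) => (N ^ (j : ℕ)) b) = ⊤ := by
  set S := Submodule.span K (Set.range fun j : Fin (r + 1) => (N ^ (j : ℕ)) b)
  have hS : ∀ k, (N ^ k) b ∈ S := by
    intro k
    by_cases hk : k < r + 1
    · exact Submodule.subset_span ⟨⟨k, hk⟩, rfl⟩
    · obtain ⟨m, rfl⟩ := Nat.exists_eq_add_of_le (not_lt.1 hk)
      rw [add_comm, pow_add, Module.End.mul_apply, h2, map_zero]
      exact S.zero_mem
  have key : ∀ k (y : V), ∃ s ∈ S, ∃ z, y = s + (N ^ k) z := by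
    intro k
    induction k with
    | zero => exact fun y => ⟨0, S.zero_mem, y, by simp⟩
    | succ k ih =>
      intro y
      obtain ⟨s, hs, z, rfl⟩ := ih y
      have hz : z ∈ LinearMap.range N ⊔ Submodule.span K {b} := htop ▸ Submodule.mem_top
      obtain ⟨_, ⟨u, rfl⟩, _, hc, rfl⟩ := Submodule.mem_sup.1 hz
      obtain ⟨c, rfl⟩ := Submodule.mem_span_singleton.1 hc
      refine ⟨s + c • (N ^ k) b, S.add_mem hs (S.smul_mem _ (hS k)), u, ?_⟩
      rw [map_add, map_smul, pow_succ, Module.End.mul_apply]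
      abel
  obtain ⟨k, hk⟩ := hN
  refine eq_top_iff.2 fun y _ => ?_
  obtain ⟨s, hs, z, rfl⟩ := key k y
  rw [hk, LinearMap.zero_apply, add_zero]
  exact hs

theorem exists_cyclic_basis (hN : IsNilpotent N) (hN0 : N ≠ 0) (hb : b ≠ 0)
    (htop : LinearMap.range N ⊔ Submodule.span K {b} = ⊤) :
    ∃ r, 1 ≤ r ∧ (N ^ r) b ≠ 0 ∧ (N ^ (r + 1)) b = 0 ∧
      ∃ B : Module.Basis (Fin (r + 1)) K V, ∀ j, B j = (N ^ (j : ℕ)) b := by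
  classical
  have hex : ∃ k, (N ^ k) b = 0 := by
    obtain ⟨k, hk⟩ := hN
    exact ⟨k, by rw [hk, LinearMap.zero_apply]⟩
  obtain ⟨r, hr⟩ : ∃ r, Nat.find hex = r + 1 := by
    refine Nat.exists_eq_succ_of_ne_zero fun h0 => hb ?_
    simpa [h0] using Nat.find_spec hex
  have h1 : (N ^ r) b ≠ 0 := Nat.find_min hex (by omega)
  have h2 : (N ^ (r + 1)) b = 0 := hr ▸ Nat.find_spec hex
  let B := Module.Basis.mk (linearIndependent_pow_apply h1 h2)
    (span_pow_apply_eq_top hN htop h2).ge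
  have hB : ∀ j, B j = (N ^ (j : ℕ)) b := fun j => by simp [B]
  refine ⟨r, ?_, h1, h2, B, hB⟩
  rw [Nat.one_le_iff_ne_zero]
  rintro rfl
  refine hN0 (B.ext fun j => ?_)
  have hj : (j : ℕ) = 0 := by omega
  rw [hB, hj]
  simpa using h2

theorem exists_smul_of_cyclic_basis {r : ℕ} (h2 : (N ^ (r + 1)) b = 0)
    (B : Module.Basis (Fin (r + 1)) K V) (hB : ∀ j, B j = (N ^ (j : ℕ)) b) {v : V}
    (hv : N v = 0) : ∃ κ : K, v = κ • (N ^ r) b := by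
  have h3 := B.sum_repr v
  rw [Fin.sum_univ_castSucc] at h3
  have h4 := congrArg N h3
  rw [hv, map_add, map_sum, map_smul, hB (Fin.last r), ← Module.End.mul_apply, ← pow_succ',
    Fin.val_last, h2, smul_zero, add_zero] at h4
  have h5 : ∑ j : Fin r, B.repr v j.castSucc • B j.succ = 0 := by
    rw [← h4]
    refine Finset.sum_congr rfl fun j _ => ?_
    rw [map_smul, hB, hB, ← Module.End.mul_apply, ← pow_succ']
    rfl
  have hli := B.linearIndependent.comp _ (Fin.succ_injective r)
  have h6 := Fintype.linearIndependent_iff.1 hli _ h5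
  refine ⟨B.repr v (Fin.last r), ?_⟩
  simp only [h6, zero_smul, Finset.sum_const_zero, zero_add, hB, Fin.val_last] at h3
  exact h3.symm

/-- The sum `1 + A + ⋯ + A ^ (q - 1)` for `A = 1 + N`. -/
noncomputable def geomSum (N : Module.End K V) (q : ℕ) : Module.End K V :=
  ∑ i ∈ Finset.range q, (1 + N) ^ i

theorem commute_geomSum (N : Module.End K V) (q : ℕ) : Commute N (geomSum N q) :=
  Commute.sum_right _ _ _ fun _ _ => ((Commute.one_right N).add_right (Commute.refl N)).pow_right _

theorem one_add_mul_geomSum (N : Module.End K V) (q : ℕ) :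
    1 + N * geomSum N q = (1 + N) ^ q := by
  have := mul_geom_sum (1 + N) q
  rw [add_sub_cancel_left] at this
  rw [geomSum, this]
  abel

theorem geomSum_apply_of_apply_eq_zero {z : V} (hz : N z = 0) (q : ℕ) :
    geomSum N q z = (q : K) • z := by
  have : ∀ i, ((1 + N : Module.End K V) ^ i) z = z := by
    intro i
    induction i with
    | zero => simp
    | succ i ih => rw [pow_succ, Module.End.mul_apply]; simp [hz, ih]
  simp [geomSum, LinearMap.sum_apply, this, Nat.cast_smul_eq_nsmul]

theorem geomSum_pow_apply_of_apply_eq_zero {z : V} (hz : N z = 0) (q k : ℕ) :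
    (geomSum N q ^ k) z = ((q : K) ^ k) • z := by
  induction k with
  | zero => simp
  | succ k ih =>
    rw [pow_succ', Module.End.mul_apply, ih, map_smul, geomSum_apply_of_apply_eq_zero hz,
      smul_smul, pow_succ]

/-- N kills N^r b, so each of the r + 1 factors `geomSum N q` acts on it as the scalar q. -/
theorem mul_geomSum_pow_apply {r : ℕ} (h2 : (N ^ (r + 1)) b = 0) (q : ℕ) :
    ((N * geomSum N q) ^ r) (geomSum N q b) = ((q : K) ^ (r + 1)) • (N ^ r) b := by
  have hz : N ((N ^ r) b) = 0 := by rw [← Module.End.mul_apply, ← pow_succ', h2]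
  rw [← geomSum_pow_apply_of_apply_eq_zero hz, (commute_geomSum N q).mul_pow,
    ← Module.End.mul_apply, ← Module.End.mul_apply]
  congr 1
  rw [mul_assoc, ← pow_succ]
  exact ((commute_geomSum N q).pow_pow r (r + 1)).eq

theorem pow_apply_eq_zero_of_cyclic_basis {r : ℕ} (h2 : (N ^ (r + 1)) b = 0)
    (B : Module.Basis (Fin (r + 1)) K V) (hB : ∀ j, B j = (N ^ (j : ℕ)) b) :
    N ^ (r + 1) = 0 :=
  B.ext fun j => by
    rw [hB, ← Module.End.mul_apply, ← pow_add, add_comm, pow_add, Module.End.mul_apply, h2,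
      map_zero, LinearMap.zero_apply]

/-- An affine map with full Jordan block is conjugate to its powers. -/
theorem exists_linearEquiv_conj [CharZero K] {r : ℕ} (h1 : (N ^ r) b ≠ 0)
    (h2 : (N ^ (r + 1)) b = 0) (B : Module.Basis (Fin (r + 1)) K V)
    (hB : ∀ j, B j = (N ^ (j : ℕ)) b) {q : ℕ} (hq : q ≠ 0) :
    ∃ β : V ≃ₗ[K] V, (∀ x, β (N x) = (N * geomSum N q) (β x)) ∧ β b = geomSum N q b ∧
      β ((N ^ r) b) = ((q : K) ^ (r + 1)) • (N ^ r) b := by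
  have hfin : FiniteDimensional K V := B.finiteDimensional_of_finite
  have hN := pow_apply_eq_zero_of_cyclic_basis h2 B hB
  set M := N * geomSum N q with hM
  set c := geomSum N q b with hc
  have e1 : (M ^ r) c = ((q : K) ^ (r + 1)) • (N ^ r) b := mul_geomSum_pow_apply h2 q
  have e2 : M ^ (r + 1) = 0 := by rw [hM, (commute_geomSum N q).mul_pow, hN, zero_mul]
  have hli : LinearIndependent K (fun j : Fin (r + 1) => (M ^ (j : ℕ)) c) :=
    linearIndependent_pow_apply (by
      rw [e1]
      exact smul_ne_zero (pow_ne_zero _ (Nat.cast_ne_zero.2 hq)) h1) (by rw [e2]; rfl)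
  let C := basisOfLinearIndependentOfCardEqFinrank hli
    (by rw [Module.finrank_eq_card_basis B])
  have hC : ∀ j, C j = (M ^ (j : ℕ)) c := fun j => by simp [C]
  -- β matches the Jordan basis generated by `b` under `N` with the one generated by `c` under `M`.
  let β := B.equiv C (Equiv.refl _)
  have hβ : ∀ j ≤ r, β ((N ^ j) b) = (M ^ j) c := fun j hj => by
    have := B.equiv_apply (b' := C) (i := ⟨j, Nat.lt_succ_of_le hj⟩) (e := Equiv.refl _)
    rw [hB, Equiv.refl_apply, hC] at this
    exact this
  have hlin : (β : V →ₗ[K] V).comp N = M.comp (β : V →ₗ[K] V) := by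
    refine B.ext fun j => ?_
    simp only [LinearMap.comp_apply, LinearEquiv.coe_coe]
    rw [hB, hβ j (by omega), ← Module.End.mul_apply, ← Module.End.mul_apply, ← pow_succ',
      ← pow_succ']
    rcases Nat.lt_or_ge j r with hj | hj
    · exact hβ _ hj
    · have : (j : ℕ) = r := by omega
      rw [this, e2, hN]
      simp
  exact ⟨β, fun x => LinearMap.congr_fun hlin x, by simpa using hβ 0 (Nat.zero_le _),
    (hβ r le_rfl).trans e1⟩

end Cyclic

variable {K : Type*} [Field K] {n : ℕ}

/-- The right-hand side is the q-th power of the affine map y ↦ y + Ny + b. -/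
theorem conj_translation_nat {h : (Fin n → K) → (Fin n → K)} {v b : Fin n → K}
    {N : Module.End K (Fin n → K)} (hN : ∀ x, h (x + v) = h x + (N (h x) + b)) (q : ℕ)
    (x : Fin n → K) :
    h (x + (q : K) • v) = h x + ((N * geomSum N q) (h x) + geomSum N q b) := by
  have h1 : ∀ y, y + (N * geomSum N q) y = ((1 + N) ^ q) y := fun y => by
    rw [← one_add_mul_geomSum]; rfl
  rw [← add_assoc, h1]
  clear h1
  induction q with
  | zero => simp [geomSum]
  | succ q ih =>
    push_cast
    rw [add_smul, one_smul, ← add_assoc, hN, ih]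
    have h2 : geomSum N (q + 1) b = b + (1 + N) (geomSum N q b) := by
      rw [geomSum, geomSum, Finset.sum_range_succ', add_comm, ← Module.End.mul_apply,
        Finset.mul_sum]
      simp [pow_succ']
    rw [h2, pow_succ', Module.End.mul_apply]
    simp
    abel

/-! ### Vanishing of the nilpotent part -/

section Rigid

variable {Γ : Subgroup (Equiv.Perm (Fin n → K))} {h : Equiv.Perm (Fin n → K)}
  {v b : Fin n → K} {N : Module.End K (Fin n → K)}

/-- A linear β conjugates the full Jordan block map to its square, so δ = h⁻¹βh satisfies δ(x + v) =
δx + 2v and is affine. As β multiplies v₁ by q = 2^(r+1), δ also conjugates y ↦ y + N'y + b' to its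
q-th power, so its linear part D scales N'^r' b' by q^(r'+1). But v lies on that line, so 2 =
q^(r'+1), impossible for r, r' ≥ 1. -/
theorem IsRigid.linear_part_eq_zero [CharZero K] (hR : IsRigid Γ) (hΓ : IsOverAffine Γ)
    (hh : h ∈ Γ) (hv : v ≠ 0) (hN : ∀ x, h (x + v) = h x + (N (h x) + b)) : N = 0 := by
  by_contra hN0
  obtain ⟨r, hr, h1, h2, B, hB⟩ := exists_cyclic_basis
    (isNilpotent_of_conj_translation (hΓ.poly h hh) h.surjective hN) hN0
    (fun h0 => notMem_range_of_conj_translation h.bijective hv hN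
      (by rw [h0]; exact Submodule.zero_mem _))
    (hR.range_sup_span_eq_top hΓ hh hv hN hN0)
  set v₁ := (N ^ r) b with hv₁def
  have hNv₁ : N v₁ = 0 := by rw [hv₁def, ← Module.End.mul_apply, ← pow_succ', h2]
  obtain ⟨N', b', hN', hN'0, hN'v⟩ := hR.exists_conj_translation hΓ hh hv hN hN0 h1 hNv₁
  have hh' := inv_mem hh
  obtain ⟨r', hr', h1', h2', B', hB'⟩ := exists_cyclic_basis
    (isNilpotent_of_conj_translation (hΓ.poly _ hh')
      (h⁻¹ : Equiv.Perm (Fin n → K)).surjective hN') hN'0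
    (fun h0 => notMem_range_of_conj_translation
      (h⁻¹ : Equiv.Perm (Fin n → K)).bijective h1 hN'
      (by rw [h0]; exact Submodule.zero_mem _))
    (hR.range_sup_span_eq_top hΓ hh' h1 hN' hN'0)
  obtain ⟨κ, hκ⟩ := exists_smul_of_cyclic_basis h2' B' hB' hN'v
  have hκ0 : κ ≠ 0 := by
    rintro rfl
    exact hv (by rw [hκ, zero_smul])
  obtain ⟨β, hβN, hβb, hβv₁⟩ := exists_linearEquiv_conj h1 h2 B hB (q := 2) two_ne_zero
  have hδmem : h⁻¹ * β.toEquiv * h ∈ Γ :=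
    mul_mem (mul_mem hh' (hΓ.aff _ ⟨β, 0, fun x => by simp⟩)) hh
  have hδ : ∀ x, h ((h⁻¹ * β.toEquiv * h) x) = β (h x) := fun x => by
    simp only [Equiv.Perm.mul_apply]
    rw [perm_apply_inv_self]
    rfl
  set δ := h⁻¹ * β.toEquiv * h
  have hδv : ∀ x, δ (x + v) = δ x + (2 : K) • v := fun x => by
    apply h.injective
    have := conj_translation_nat hN 2 (δ x)
    push_cast at this
    rw [this, hδ, hδ, hN, map_add, map_add, hβN, hβb]
  obtain ⟨D, d, hD⟩ := hR δ hδmem v _ hv hδv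
  have hDv : D v = (2 : K) • v := by
    have := hδv 0
    rw [hD, hD, zero_add, map_zero, zero_add, add_comm] at this
    exact add_left_cancel this
  let q : ℕ := 2 ^ (r + 1)
  have hrel : ∀ x, δ (x + (N' x + b')) =
      δ x + ((N' * geomSum N' q) (δ x) + geomSum N' q b') := by
    intro x
    apply h.injective
    have e1 : x + (N' x + b') = h⁻¹ (h x + v₁) := by
      rw [hN', perm_inv_apply_self]
    have e2 := conj_translation_nat hN' q (h (δ x))
    rw [perm_inv_apply_self] at e2
    rw [hδ, e1, ← e2, perm_apply_inv_self, perm_apply_inv_self, map_add, hβv₁, hδ]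
    simp [q, hv₁def]
  set M' := N' * geomSum N' q with hM'
  set c' := geomSum N' q b' with hc'
  have hDb : D b' = M' d + c' := by
    have := hrel 0
    rw [hD, hD] at this
    simp only [map_zero, zero_add] at this
    rw [add_comm] at this
    exact add_left_cancel this
  have hDN : ∀ x, D (N' x) = M' (D x) := fun x => by
    have := hrel x
    rw [hD, hD, map_add, map_add, map_add, hDb] at this
    have e : D (N' x) + (D x + M' d + c' + d) = M' (D x) + (D x + M' d + c' + d) := by
      calc _ = D x + (D (N' x) + (M' d + c')) + d := by abel
        _ = _ := by rw [this]; abel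
    exact add_right_cancel e
  have hDpow : ∀ k, D ((N' ^ k) b') = (M' ^ k) (D b') := by
    intro k
    induction k with
    | zero => simp
    | succ k ih => rw [pow_succ', pow_succ', Module.End.mul_apply, Module.End.mul_apply, hDN, ih]
  have hz : D ((N' ^ r') b') = ((q : K) ^ (r' + 1)) • (N' ^ r') b' := by
    rw [hDpow, hDb, map_add, ← Module.End.mul_apply, ← pow_succ, hM',
      (commute_geomSum N' q).mul_pow, pow_apply_eq_zero_of_cyclic_basis h2' B' hB', zero_mul,
      LinearMap.zero_apply, zero_add, hc', mul_geomSum_pow_apply h2']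
  have hfin : ((2 : K) - (q : K) ^ (r' + 1)) • v = 0 := by
    rw [sub_smul, ← hDv, hκ, map_smul, hz, smul_comm, sub_self]
  have h3 : (2 : K) = (q : K) ^ (r' + 1) :=
    sub_eq_zero.1 ((smul_eq_zero.1 hfin).resolve_right hv)
  have h4 : 2 ^ 1 = 2 ^ ((r + 1) * (r' + 1)) := by
    rw [pow_mul]
    have : ((2 : ℕ) : K) = ((q ^ (r' + 1) : ℕ) : K) := by push_cast; exact h3
    simpa using Nat.cast_injective this
  have h5 := Nat.pow_right_injective (le_refl 2) h4
  nlinarith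

/-- An element of a rigid group which conjugates a nontrivial translation to an affine map
is affine. -/
theorem IsRigid.isAffMap_of_conj_translation [CharZero K] (hR : IsRigid Γ)
    (hΓ : IsOverAffine Γ) (hh : h ∈ Γ) (hv : v ≠ 0)
    (ha : IsAffMap (h * Equiv.addRight v * h⁻¹ : Equiv.Perm (Fin n → K))) : IsAffMap h := by
  obtain ⟨A, b, hA⟩ := ha
  have hA' : ∀ x, h (x + v) = A (h x) + b := fun x => by
    rw [← hA]
    simp
  have hN : ∀ x, h (x + v) = h x + ((A - 1) (h x) + b) := fun x => by
    rw [hA', LinearMap.sub_apply, Module.End.one_apply]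
    abel
  have h0 := hR.linear_part_eq_zero hΓ hh hv hN
  exact hR h hh v b hv fun x => by rw [hN, h0]; simp

end Rigid

end PolyMap

/-! ### Shears in a non-rigid group -/

namespace PolyMap

variable {K : Type*} [Field K] {n : ℕ}

/-- Affine functions on affine `n`-space. -/
def IsAffFun (f : (Fin n → K) → K) : Prop :=
  ∃ (l : (Fin n → K) →ₗ[K] K) (c : K), ∀ x, f x = l x + c

theorem IsAffFun.sum {ι : Type*} (s : Finset ι) {f : ι → (Fin n → K) → K}
    (hf : ∀ i ∈ s, IsAffFun (f i)) : IsAffFun (fun x => ∑ i ∈ s, f i x) := by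
  choose! l c h using hf
  refine ⟨∑ i ∈ s, l i, ∑ i ∈ s, c i, fun x => ?_⟩
  rw [LinearMap.sum_apply, ← Finset.sum_add_distrib]
  exact Finset.sum_congr rfl fun i hi => h i hi x

theorem isAffFun_eval_of_totalDegree_le_one {p : MvPolynomial (Fin n) K}
    (hp : p.totalDegree ≤ 1) : IsAffFun (fun x => eval x p) := by
  simp only [MvPolynomial.eval_eq']
  refine IsAffFun.sum _ fun d hd => ?_
  have hd1 : d.degree ≤ 1 := (le_totalDegree hd).trans hp
  rcases Nat.le_one_iff_eq_zero_or_eq_one.1 hd1 with h0 | h1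
  · rw [Finsupp.degree_eq_zero_iff] at h0
    exact ⟨0, p.coeff d, fun x => by simp [h0]⟩
  · obtain ⟨i, rfl⟩ := (Finsupp.sum_eq_one_iff d).1 h1
    refine ⟨(p.coeff (Finsupp.single i 1)) • LinearMap.proj i, 0, fun x => ?_⟩
    dsimp only
    rw [Finset.prod_eq_single i]
    · simp
    · intro j _ hj
      rw [Finsupp.single_eq_of_ne hj, pow_zero]
    · simp

theorem isAffMap_of_isAffFun {f : (Fin n → K) → (Fin n → K)}
    (hf : ∀ i, IsAffFun (fun x => f x i)) : IsAffMap f := by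
  choose l c h using hf
  exact ⟨LinearMap.pi l, c, fun x => funext fun i => h i x⟩

theorem eval_smul_of_isHomogeneous {p : MvPolynomial (Fin n) K} {k : ℕ} (hp : p.IsHomogeneous k)
    (c : K) (x : Fin n → K) : eval (c • x) p = c ^ k * eval x p := by
  rw [MvPolynomial.eval_eq', MvPolynomial.eval_eq', Finset.mul_sum]
  refine Finset.sum_congr rfl fun d hd => ?_
  have h1 : ∑ i, d i = k := by
    rw [← Finsupp.degree_eq_sum, Finsupp.degree_eq_weight_one]
    exact hp (mem_support_iff.1 hd)
  simp only [Pi.smul_apply, smul_eq_mul, mul_pow, Finset.prod_mul_distrib]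
  rw [Finset.prod_pow_eq_pow_sum, h1]
  ring

theorem IsPolyFun.exists_direction [Infinite K] {f : (Fin n → K) → K} (hf : IsPolyFun f)
    (hna : ¬ IsAffFun f) :
    ∃ (d : Fin n → K) (q : Polynomial K), (∀ c : K, f (c • d) = q.eval c) ∧
      ∃ k, 2 ≤ k ∧ q.coeff k ≠ 0 := by
  obtain ⟨p, hp⟩ := hf
  have hdeg : 2 ≤ p.totalDegree := by
    by_contra! hlt
    apply hna
    have := isAffFun_eval_of_totalDegree_le_one (p := p) (by omega)
    rwa [← funext hp] at this
  have hne : homogeneousComponent p.totalDegree p ≠ 0 := by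
    intro h0
    obtain ⟨d, hd, hdeg'⟩ := Finset.exists_mem_eq_sup p.support
      (support_nonempty.2 (by rintro rfl; simp at hdeg)) (fun s => s.sum fun _ e => e)
    have h1 := congrArg (coeff d) h0
    rw [coeff_homogeneousComponent, if_pos, coeff_zero] at h1
    · exact (mem_support_iff.1 hd) h1
    · exact hdeg'.symm
  obtain ⟨d, hd⟩ : ∃ d, eval d (homogeneousComponent p.totalDegree p) ≠ 0 := by
    by_contra! hc
    exact hne (MvPolynomial.funext fun x => by rw [hc x, map_zero])
  refine ⟨d, ∑ k ∈ Finset.range (p.totalDegree + 1),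
    Polynomial.monomial k (eval d (homogeneousComponent k p)), fun c => ?_, p.totalDegree, hdeg, ?_⟩
  · rw [hp]
    conv_lhs => rw [← sum_homogeneousComponent p]
    rw [map_sum, Polynomial.eval_finsetSum]
    refine Finset.sum_congr rfl fun k _ => ?_
    rw [eval_smul_of_isHomogeneous (homogeneousComponent_isHomogeneous k p),
      Polynomial.eval_monomial, mul_comm]
  · simp only [Polynomial.finsetSum_coeff, Polynomial.coeff_monomial]
    rw [Finset.sum_ite_eq']
    simpa using hd

/-- The polynomials `f` for which the shear `x ↦ x + f(x) w` belongs to `Γ`. -/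
def shearModule {Γ : Subgroup (Equiv.Perm (Fin n → K))} (hΓ : IsOverAffine Γ) (w : Fin n → K) :
    Submodule K ((Fin n → K) → K) where
  carrier := {f | IsPolyFun f ∧ (∀ (x : Fin n → K) (c : K), f (x + c • w) = f x) ∧
    ∃ g ∈ Γ, ∀ x, g x = x + f x • w}
  zero_mem' := ⟨IsPolyFun.const 0, fun _ _ => rfl, 1, one_mem _, fun x => by simp⟩
  add_mem' := by
    rintro f f' ⟨h1, h2, g, hg, h3⟩ ⟨h1', h2', g', hg', h3'⟩
    refine ⟨h1.add h1', fun x c => by simp [h2, h2'], g * g', mul_mem hg hg', fun x => ?_⟩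
    rw [Equiv.Perm.mul_apply, h3, h3', h2]
    simp only [Pi.add_apply, add_smul]
    abel
  smul_mem' := by
    rintro c f ⟨h1, h2, g, hg, h3⟩
    refine ⟨(IsPolyFun.const c).mul h1, fun x c => by simp [h2], ?_⟩
    by_cases hw : w = 0
    · exact ⟨1, one_mem _, fun x => by simp [hw]⟩
    by_cases hc : c = 0
    · exact ⟨1, one_mem _, fun x => by simp [hc]⟩
    obtain ⟨s, hs, -⟩ := exists_functional (K := K) (S := (⊥ : Submodule K (Fin n → K)))
      (b := w) (by simpa using hw)
    -- L multiplies w by c and fixes ker s, so conjugation by L multiplies the shear factor by c.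
    let L : Equiv.Perm (Fin n → K) :=
      ⟨fun x => x + ((c - 1) * s x) • w, fun x => x + ((c⁻¹ - 1) * s x) • w,
        fun x => by
          simp only [map_add, map_smul, hs, smul_eq_mul, mul_one]
          rw [add_assoc, ← add_smul]
          have : (c - 1) * s x + (c⁻¹ - 1) * (s x + (c - 1) * s x) = 0 := by field_simp; ring
          rw [this, zero_smul, add_zero],
        fun x => by
          simp only [map_add, map_smul, hs, smul_eq_mul, mul_one]
          rw [add_assoc, ← add_smul]
          have : (c⁻¹ - 1) * s x + (c - 1) * (s x + (c⁻¹ - 1) * s x) = 0 := by field_simp; ring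
          rw [this, zero_smul, add_zero]⟩
    have hL : IsAffMap L := ⟨LinearMap.id + ((c - 1) • s).smulRight w, 0, fun x => by simp [L]⟩
    refine ⟨L * g * L⁻¹, mul_mem (mul_mem (hΓ.aff _ hL) hg) (inv_mem (hΓ.aff _ hL)), fun x => ?_⟩
    obtain ⟨y, rfl⟩ := L.surjective x
    rw [Equiv.Perm.mul_apply, perm_inv_apply_self, Equiv.Perm.mul_apply, h3]
    simp only [L, Equiv.coe_fn_mk, map_add, map_smul, hs, Pi.smul_apply, h2, smul_eq_mul, mul_one]
    module

section

variable {Γ : Subgroup (Equiv.Perm (Fin n → K))} {hΓ : IsOverAffine Γ} {w : Fin n → K}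
  {f : (Fin n → K) → K}

theorem mem_of_forall_eq {M : Submodule K ((Fin n → K) → K)} {f g : (Fin n → K) → K}
    (hf : f ∈ M) (h : ∀ x, f x = g x) : g ∈ M :=
  funext h ▸ hf

theorem const_mem_shearModule (c : K) : (fun _ => c) ∈ shearModule hΓ w :=
  ⟨IsPolyFun.const c, fun _ _ => rfl, Equiv.addRight (c • w),
    hΓ.aff _ (IsAffMap.translation _), fun _ => rfl⟩

theorem comp_mem_shearModule (hf : f ∈ shearModule hΓ w) {κ : Equiv.Perm (Fin n → K)}
    (hκ : IsAffMap κ) {w' : Fin n → K} {a : K} (ha : a ≠ 0)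
    (hw : ∀ x (c : K), κ (x + c • w') = κ x + (c * a) • w) :
    (fun x => f (κ x)) ∈ shearModule hΓ w' := by
  obtain ⟨h1, h2, g, hg, h3⟩ := hf
  have h4 : (fun x => a⁻¹ * f (κ x)) ∈ shearModule hΓ w' := by
    refine ⟨(IsPolyFun.const _).mul (h1.comp hκ.isPolyFun), fun x c => by simp [hw, h2],
      κ⁻¹ * g * κ, mul_mem (mul_mem (inv_mem (hΓ.aff _ hκ)) hg) (hΓ.aff _ hκ), fun x => ?_⟩
    rw [Equiv.Perm.mul_apply, Equiv.Perm.mul_apply, h3, Equiv.Perm.inv_eq_iff_eq, hw]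
    congr 2
    field_simp
  have h5 := (shearModule hΓ w').smul_mem a h4
  convert h5 using 1
  funext x
  simp [ha]

/-- Conjugating the shear of `f` by that of `e` keeps the direction `w`, because `e` is constant
along `w`. -/
theorem comp_shear_mem_shearModule {w' : Fin n → K} {e : (Fin n → K) → K}
    (he : e ∈ shearModule hΓ w') (hew : ∀ (x : Fin n → K) (c : K), e (x + c • w) = e x)
    (hf : f ∈ shearModule hΓ w) : (fun x => f (x + e x • w')) ∈ shearModule hΓ w := by
  obtain ⟨h1, h2, g, hg, h3⟩ := hf
  obtain ⟨h1', h2', g', hg', h3'⟩ := he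
  refine ⟨h1.comp fun i => (IsPolyFun.coord i).add (h1'.mul (IsPolyFun.const (w' i))),
    fun x c => ?_, g'⁻¹ * g * g', mul_mem (mul_mem (inv_mem hg') hg) hg', fun x => ?_⟩
  · change f (x + c • w + e (x + c • w) • w') = f (x + e x • w')
    rw [hew, add_right_comm, h2]
  · rw [Equiv.Perm.mul_apply, Equiv.Perm.mul_apply, h3, Equiv.Perm.inv_eq_iff_eq, h3', h3', hew]
    abel

/-- Take a non-affine h with h(x + v) = hx + w. Conjugating x ↦ x + l(x)v, where l v = 0, by h gives
a shear along w with factor l ∘ h⁻¹. If all of these are affine, h⁻¹ is affine up to a shear σ along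
v; then σ lies in Γ, and if it is affine too, so is h. -/
theorem exists_not_isAffFun_mem_shearModule [CharZero K] (hΓ : IsOverAffine Γ)
    (hR : ¬ IsRigid Γ) :
    ∃ w ≠ 0, ∃ f ∈ shearModule hΓ w, ¬ IsAffFun f := by
  unfold IsRigid at hR
  push Not at hR
  obtain ⟨h, hh, v, w, hv, hvw, hna⟩ := hR
  by_contra! hcon
  have hw : w ≠ 0 := by
    rintro rfl
    have := hvw 0
    rw [add_zero] at this
    exact hv (by simpa using h.injective this)
  have hline := line_eq_of_nat (hΓ.poly h hh) hvw
  have hline' : ∀ (c : K) y, h⁻¹ (y + c • w) = h⁻¹ y + c • v := fun c y => by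
    rw [Equiv.Perm.inv_eq_iff_eq, hline, perm_apply_inv_self]
  have hpi := hΓ.poly _ (inv_mem hh)
  have key : ∀ l : (Fin n → K) →ₗ[K] K, l v = 0 → IsAffFun (fun y => l (h⁻¹ y)) := by
    intro l hl
    refine hcon w hw _ ⟨IsPolyFun.linear_comp l hpi, fun x c => by simp [hline', hl], ?_⟩
    let E : Equiv.Perm (Fin n → K) :=
      ⟨fun x => x + l x • v, fun x => x - l x • v, fun x => by simp [hl], fun x => by simp [hl]⟩
    have hE : IsAffMap E := ⟨LinearMap.id + l.smulRight v, 0, fun y => by simp [E]⟩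
    refine ⟨h * E * h⁻¹, mul_mem (mul_mem hh (hΓ.aff _ hE)) (inv_mem hh), fun y => ?_⟩
    simp only [Equiv.Perm.mul_apply, E, Equiv.coe_fn_mk]
    rw [hline, perm_apply_inv_self]
  obtain ⟨s, hs, -⟩ := exists_functional (K := K) (S := (⊥ : Submodule K (Fin n → K)))
    (b := v) (by simpa using hv)
  obtain ⟨s', hs', -⟩ := exists_functional (K := K) (S := (⊥ : Submodule K (Fin n → K)))
    (b := w) (by simpa using hw)
  -- Both terms grow by c under translation by c • w, so p is constant along w and σ below is a
  -- shear.
  let p : (Fin n → K) → K := fun y => s (h⁻¹ y) - s' y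
  have hp : ∀ y (c : K), p (y + c • w) = p y := fun y c => by
    simp only [p, hline', map_add, map_smul, hs, hs', smul_eq_mul]
    ring
  have hph : ∀ x (c : K), p (h (x + c • v)) = p (h x) := fun x c => by rw [hline, hp]
  have hph' : ∀ x (c : K), p (h (x - c • v)) = p (h x) := fun x c => by
    rw [sub_eq_add_neg, ← neg_smul, hph]
  let σ : Equiv.Perm (Fin n → K) :=
    ⟨fun x => x - p (h x) • v, fun x => x + p (h x) • v,
      fun x => by simp [hph'], fun x => by simp [hph]⟩
  have hσ : ∀ x, σ x = x - p (h x) • v := fun _ => rfl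
  have hL : IsAffMap (σ * h⁻¹ : Equiv.Perm (Fin n → K)) := by
    have h1 : IsAffMap (fun y => h⁻¹ y - s (h⁻¹ y) • v) := by
      refine isAffMap_of_isAffFun fun i => ?_
      have := key (LinearMap.proj i - (v i) • s) (by simp [hs])
      refine (funext fun y => ?_ : (fun y => _) = _) ▸ this
      simp [mul_comm]
    obtain ⟨A, b, hA⟩ := h1
    refine ⟨A + s'.smulRight v, b, fun y => ?_⟩
    rw [Equiv.Perm.mul_apply, hσ, perm_apply_inv_self]
    simp only [p, LinearMap.add_apply, LinearMap.smulRight_apply]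
    rw [add_right_comm, ← hA]
    module
  have hσmem : σ ∈ Γ := by
    have := mul_mem (hΓ.aff _ hL) hh
    rwa [inv_mul_cancel_right] at this
  have hσaff : IsAffFun (fun x => - p (h x)) := by
    refine hcon v hv _ ⟨?_, fun x c => by simp only [hph], σ, hσmem, fun x => ?_⟩
    · have h1 : IsPolyFun (fun x => (-1 : K) * p (h x)) := by
        refine (IsPolyFun.const (-1)).mul (IsPolyFun.comp ?_ (hΓ.poly h hh))
        exact (IsPolyFun.linear_comp s hpi).sub (IsPolyFun.linear s')
      simpa using h1
    · rw [hσ, neg_smul, sub_eq_add_neg]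
  obtain ⟨l, c, hl⟩ := hσaff
  have hσ' : IsAffMap σ := ⟨LinearMap.id + l.smulRight v, c • v, fun x => by
    have h3 := hl x
    simp only at h3
    rw [hσ, sub_eq_add_neg, ← neg_smul, h3]
    simp [add_smul, add_assoc]⟩
  apply hna
  have h2 := hL.symm.comp hσ'
  refine (funext fun x => ?_ : (fun x => _) = ⇑h) ▸ h2
  rw [← Equiv.Perm.mul_apply]
  simp

/-- Choose a line on which `f` restricts to q of degree at least 2. Degenerating x ↦ l(x)d + cx to c
= 0 gives q ∘ l, scalings isolate l^k, and translations along d lower it to l². -/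
theorem sq_mem_shearModule [CharZero K] (hf : f ∈ shearModule hΓ w) (hna : ¬ IsAffFun f) :
    ∃ (l : (Fin n → K) →ₗ[K] K) (d : Fin n → K), l d = 1 ∧ l w = 0 ∧
      (fun x => l x ^ 2) ∈ shearModule hΓ w := by
  obtain ⟨d, q, hq, k, hk, hqk⟩ := hf.1.exists_direction hna
  have hd : d ∉ Submodule.span K {w} := by
    intro hd
    obtain ⟨a, rfl⟩ := Submodule.mem_span_singleton.1 hd
    have : q = Polynomial.C (f 0) := Polynomial.funext fun c => by
      rw [← hq, Polynomial.eval_C, smul_smul]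
      simpa using hf.2.1 0 (c * a)
    rw [this, Polynomial.coeff_C, if_neg (by omega)] at hqk
    exact hqk rfl
  obtain ⟨l, hld, hl⟩ := exists_functional hd
  have hlw : l w = 0 := hl w (Submodule.mem_span_singleton_self w)
  refine ⟨l, d, hld, hlw, ?_⟩
  -- restriction to the line spanned by `d`
  have h1 : (fun x => q.eval (l x)) ∈ shearModule hΓ w := by
    obtain ⟨P, hP⟩ := hf.1.exists_family (W := Fin n → K) (fun x => l x • d) (fun x => x)
    have h2 := mem_of_infinite_eval_mem (shearModule hΓ w) P
      -- These are the two parameters at which κ is not invertible.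
      (S := ({0, -1} : Set K)ᶜ) (Set.Finite.infinite_compl (Set.toFinite _)) (fun c hc => by
        simp only [Set.mem_compl_iff, Set.mem_insert_iff, Set.mem_singleton_iff, not_or] at hc
        obtain ⟨hc0, hc1⟩ := hc
        have hc1' : 1 + c ≠ 0 := fun h => hc1 (by linear_combination h)
        let κ : Equiv.Perm (Fin n → K) :=
          ⟨fun x => l x • d + c • x, fun y => c⁻¹ • (y - ((1 + c)⁻¹ * l y) • d),
            fun x => by
              simp only [map_add, map_smul, hld, smul_eq_mul, mul_one]
              rw [show (1 + c)⁻¹ * (l x + c * l x) = l x by field_simp, add_sub_cancel_left,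
                smul_smul, inv_mul_cancel₀ hc0, one_smul],
            fun y => by
              simp only [map_sub, map_smul, hld, smul_eq_mul, mul_one]
              rw [smul_smul, mul_inv_cancel₀ hc0, one_smul,
                show c⁻¹ * (l y - (1 + c)⁻¹ * l y) = (1 + c)⁻¹ * l y by field_simp; ring]
              abel⟩
        have hκ : IsAffMap κ :=
          ⟨l.smulRight d + c • LinearMap.id, 0, fun x => by simp [κ]⟩
        have := comp_mem_shearModule hf hκ hc0 (w' := w) (fun x c' => by
          simp only [κ, Equiv.coe_fn_mk, map_add, map_smul, hlw]
          module)
        refine mem_of_forall_eq this fun x => ?_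
        rw [← hP]
        rfl) 0
    refine mem_of_forall_eq h2 fun x => ?_
    rw [← hq, Polynomial.coeff_zero_eq_eval_zero]
    have := hP 0 x
    rw [zero_smul, add_zero] at this
    exact this.symm
  -- separation of the degrees
  have h3 : (fun x => l x ^ k) ∈ shearModule hΓ w := by
    let P : Polynomial ((Fin n → K) → K) := ∑ i ∈ Finset.range (q.natDegree + 1),
      Polynomial.monomial i (fun x => q.coeff i * l x ^ i)
    have h2 := mem_of_infinite_eval_mem (shearModule hΓ w) P
      (S := ({0} : Set K)ᶜ) (Set.Finite.infinite_compl (Set.toFinite _)) (fun c hc => by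
        simp only [Set.mem_compl_iff, Set.mem_singleton_iff] at hc
        have := comp_mem_shearModule h1 (κ := (LinearEquiv.smulOfNeZero K (Fin n → K) c hc).toEquiv)
          ⟨c • LinearMap.id, 0, fun x => by simp⟩ hc (w' := w) (fun x c' => by
            simp [smul_smul, mul_comm])
        refine mem_of_forall_eq this fun x => ?_
        simp only [P, Polynomial.eval_finsetSum, Polynomial.eval_monomial, Finset.sum_apply]
        rw [Polynomial.eval_eq_sum_range]
        refine Finset.sum_congr rfl fun i _ => ?_
        simp [mul_pow]
        ring) k
    have hkd : k ≤ q.natDegree := Polynomial.le_natDegree_of_ne_zero hqk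
    have h4 : P.coeff k = fun x => q.coeff k * l x ^ k := by
      simp only [P, Polynomial.finsetSum_coeff, Polynomial.coeff_monomial]
      rw [Finset.sum_ite_eq', if_pos (Finset.mem_range.2 (by omega))]
    have h5 := (shearModule hΓ w).smul_mem (q.coeff k)⁻¹ (h4 ▸ h2)
    refine mem_of_forall_eq h5 fun x => ?_
    simp [hqk]
  have h6 := mem_of_infinite_eval_mem (shearModule hΓ w)
    ((Polynomial.X + Polynomial.C (fun x => l x)) ^ k) Set.infinite_univ (fun c _ => by
      have := comp_mem_shearModule h3 (IsAffMap.translation (c • d)) one_ne_zero (w' := w)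
        (fun x c' => by simp [add_right_comm])
      refine mem_of_forall_eq this fun x => ?_
      simp [hld, add_comm]) (k - 2)
  rw [Polynomial.coeff_X_add_C_pow, show k - (k - 2) = 2 by omega] at h6
  have hch : (k.choose (k - 2) : K) ≠ 0 :=
    Nat.cast_ne_zero.2 (Nat.choose_pos (Nat.sub_le _ _)).ne'
  have h7 := (shearModule hΓ w).smul_mem (k.choose (k - 2) : K)⁻¹ h6
  refine mem_of_forall_eq h7 fun x => ?_
  simp
  field_simp

end

end PolyMap

/-! ### From squares to all shears and triangular maps -/

namespace PolyMap

variable {K : Type*} [Field K] {n : ℕ} {Γ : Subgroup (Equiv.Perm (Fin n → K))}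
  {hΓ : IsOverAffine Γ}

/-- The permutation of the coordinates of affine `n`-space. -/
def permCoord (K : Type*) {n : ℕ} (σ : Equiv.Perm (Fin n)) : Equiv.Perm (Fin n → K) :=
  ⟨fun x i => x (σ i), fun x i => x (σ.symm i), fun x => by simp, fun x => by simp⟩

theorem isAffMap_permCoord (σ : Equiv.Perm (Fin n)) : IsAffMap (permCoord K σ) :=
  ⟨LinearMap.funLeft K K σ, 0, fun x => by simp [permCoord, LinearMap.funLeft]; rfl⟩

theorem comp_permCoord_mem_shearModule {f : (Fin n → K) → K} (σ : Equiv.Perm (Fin n)) {j : Fin n}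
    (hf : f ∈ shearModule hΓ (Pi.single j 1)) :
    (fun x => f fun i => x (σ i)) ∈ shearModule hΓ (Pi.single (σ j) 1) := by
  refine comp_mem_shearModule (w' := Pi.single (σ j) 1) hf (isAffMap_permCoord σ) one_ne_zero
    fun x c => ?_
  funext i
  simp [permCoord, Pi.single_apply]

/-- The transvection `x_m ↦ x_m + c x_i`. -/
def coordTransvection {i m : Fin n} (him : i ≠ m) (c : K) : Equiv.Perm (Fin n → K) :=
  ⟨fun x => x + (c * x i) • Pi.single m 1, fun x => x - (c * x i) • Pi.single m 1,
    fun x => by simp [him], fun x => by simp [him]⟩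

theorem comp_coordTransvection_mem_shearModule {f : (Fin n → K) → K} {i j m : Fin n}
    (him : i ≠ m) (hij : i ≠ j) (c : K) (hf : f ∈ shearModule hΓ (Pi.single j 1)) :
    (fun x => f (x + (c * x i) • Pi.single m 1)) ∈ shearModule hΓ (Pi.single j 1) := by
  refine comp_mem_shearModule (κ := coordTransvection him c) hf ?_ one_ne_zero
    fun x c' => ?_
  · exact ⟨LinearMap.id + (c • LinearMap.proj i).smulRight (Pi.single m 1), 0,
      fun x => by simp [coordTransvection]⟩
  · simp [coordTransvection, hij, add_right_comm]

/-- Linear changes of coordinates act transitively on pairs of nonzero w and l with l w = 0. -/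
theorem sq_coord_mem_shearModule {w : Fin n → K} (hw : w ≠ 0) {l : (Fin n → K) →ₗ[K] K}
    (hl : l ≠ 0) (hlw : l w = 0) (h : (fun x => l x ^ 2) ∈ shearModule hΓ w) {i j : Fin n}
    (hij : i ≠ j) : (fun x => x i ^ 2) ∈ shearModule hΓ (Pi.single j 1) := by
  -- move `w` to a coordinate vector
  obtain ⟨j₀, hj₀⟩ := Function.ne_iff.1 hw
  simp only [Pi.zero_apply] at hj₀
  let E : Equiv.Perm (Fin n → K) :=
    ⟨fun x => x + x j₀ • (w - Pi.single j₀ 1), fun y => y - (y j₀ / w j₀) • (w - Pi.single j₀ 1),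
      fun x => by
        simp
        rw [show (x j₀ + x j₀ * (w j₀ - 1)) / w j₀ = x j₀ by field_simp; ring]
        simp,
      fun x => by
        simp
        rw [show x j₀ - x j₀ / w j₀ * (w j₀ - 1) = x j₀ / w j₀ by field_simp; ring]
        simp⟩
  have hE : IsAffMap E := ⟨LinearMap.id + (LinearMap.proj j₀).smulRight (w - Pi.single j₀ 1), 0,
    fun x => by simp [E]⟩
  have h1 : (fun x => l (E x) ^ 2) ∈ shearModule hΓ (Pi.single j₀ 1) :=
    comp_mem_shearModule h hE one_ne_zero fun x c => by
      simp [E]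
      module
  let l' : (Fin n → K) →ₗ[K] K :=
    l.comp (LinearMap.id + (LinearMap.proj j₀).smulRight (w - Pi.single j₀ 1))
  have hl' : ∀ x, l (E x) = l' x := fun x => by simp [l', E]
  simp only [hl'] at h1
  have hl'j : l' (Pi.single j₀ 1) = 0 := by simp [l', hlw]
  -- move the functional to a coordinate
  obtain ⟨i₀, hi₀⟩ : ∃ i₀, l' (Pi.single i₀ 1) ≠ 0 := by
    by_contra! hc
    apply hl
    have hl'0 : l' = 0 := LinearMap.pi_ext' fun i => LinearMap.ext_ring (by simpa using hc i)
    refine LinearMap.ext fun y => ?_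
    obtain ⟨x, rfl⟩ := E.surjective y
    rw [hl', hl'0, LinearMap.zero_apply, LinearMap.zero_apply]
  have hij₀ : i₀ ≠ j₀ := by rintro rfl; exact hi₀ hl'j
  set a := l' (Pi.single i₀ 1) with ha
  let F : Equiv.Perm (Fin n → K) :=
    ⟨fun x => x + ((x i₀ - l' x) / a) • Pi.single i₀ 1, fun y => y + (l' y - y i₀) • Pi.single i₀ 1,
      fun x => by
        simp only [map_add, map_smul, ← ha, smul_eq_mul]
        rw [div_mul_cancel₀ _ hi₀, add_assoc, ← add_smul]
        simp,
      fun x => by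
        simp only [map_add, map_smul, ← ha, smul_eq_mul]
        rw [add_assoc, ← add_smul]
        simp
        field_simp
        ring⟩
  have hF : IsAffMap F := ⟨LinearMap.id + (a⁻¹ • (LinearMap.proj i₀ - l')).smulRight
    (Pi.single i₀ 1), 0, fun x => by simp [F, div_eq_inv_mul]⟩
  have h2 : (fun x => x i₀ ^ 2) ∈ shearModule hΓ (Pi.single j₀ 1) := by
    refine mem_of_forall_eq (comp_mem_shearModule h1 hF (w' := Pi.single j₀ 1) one_ne_zero
      fun x c => ?_) fun x => ?_
    · simp only [F, Equiv.coe_fn_mk, map_add, map_smul, hl'j]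
      simp [hij₀, add_right_comm]
    · simp only [F, Equiv.coe_fn_mk, map_add, map_smul, ← ha, smul_eq_mul]
      rw [div_mul_cancel₀ _ hi₀]
      ring
  -- permute the coordinates
  let b := Equiv.swap i₀ i j₀
  have hb : b ≠ i := fun hb => hij₀ (by
    have := congrArg (Equiv.swap i₀ i) hb
    simpa [b] using this.symm)
  have h3 := comp_permCoord_mem_shearModule ((Equiv.swap i₀ i).trans (Equiv.swap b j)) h2
  simp only [Equiv.trans_apply, Equiv.swap_apply_left] at h3
  rw [Equiv.swap_apply_of_ne_of_ne hb.symm hij] at h3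
  change _ ∈ shearModule hΓ (Pi.single (Equiv.swap b j b) 1) at h3
  rwa [Equiv.swap_apply_left] at h3

/-- Multiplication of shears by a coordinate, provided that there is a free variable. -/
theorem coord_mul_mem_shearModule [CharZero K]
    (hsq : ∀ i j : Fin n, i ≠ j → (fun x => x i ^ 2) ∈ shearModule hΓ (Pi.single j 1))
    {f : (Fin n → K) → K} {i j m : Fin n} (hij : i ≠ j) (hmi : m ≠ i) (hmj : m ≠ j)
    (hf : f ∈ shearModule hΓ (Pi.single j 1))
    (hfi : ∀ x (c : K), f (x + c • Pi.single i 1) = f x) :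
    (fun x => x m * f x) ∈ shearModule hΓ (Pi.single j 1) := by
  have hfi' : f ∈ shearModule hΓ (Pi.single i 1) := by
    have h1 := comp_permCoord_mem_shearModule (Equiv.swap j i) hf
    rw [Equiv.swap_apply_left] at h1
    refine mem_of_forall_eq h1 fun x => ?_
    have h2 : (fun k => x (Equiv.swap j i k)) =
        x + (x j - x i) • Pi.single i 1 + (x i - x j) • Pi.single j 1 := by
      funext k
      rcases eq_or_ne k i with rfl | hki
      · simp [hij]
      · rcases eq_or_ne k j with rfl | hkj
        · simp [hki]
        · simp [Equiv.swap_apply_of_ne_of_ne hkj hki, hki, hkj]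
    rw [h2, hf.2.1, hfi]
  -- Polarization: the squares for c = 1 and c = -1 differ by 4 x_i f.
  have h1 : ∀ c : K, (fun x => (x i + c * f x) ^ 2) ∈ shearModule hΓ (Pi.single j 1) := by
    intro c
    refine mem_of_forall_eq (comp_shear_mem_shearModule ((shearModule hΓ _).smul_mem c hfi')
      (fun x c' => by simp [hf.2.1]) (hsq i j hij)) fun x => ?_
    simp
  have h2 : (fun x => x i * f x) ∈ shearModule hΓ (Pi.single j 1) := by
    refine mem_of_forall_eq ((shearModule hΓ _).smul_mem ((4 : K)⁻¹)
      ((shearModule hΓ _).sub_mem (h1 1) (h1 (-1)))) fun x => ?_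
    simp
    ring
  -- The transvection x_i ↦ x_i + x_m fixes f and adds x_m f to x_i f.
  refine mem_of_forall_eq ((shearModule hΓ _).sub_mem
    (comp_coordTransvection_mem_shearModule hmi hmj 1 h2) h2) fun x => ?_
  simp [hfi]
  ring

theorem eval_eq_of_mem_supported {p : MvPolynomial (Fin n) K} {s : Set (Fin n)}
    (hp : p ∈ supported K s) {x y : Fin n → K} (h : ∀ i ∈ s, x i = y i) :
    eval x p = eval y p :=
  eval₂Hom_congr' rfl (fun i hi _ => h i (mem_supported.1 hp hi)) rfl

theorem eval_mem_shearModule_of_free [CharZero K]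
    (hsq : ∀ i j : Fin n, i ≠ j → (fun x => x i ^ 2) ∈ shearModule hΓ (Pi.single j 1))
    {i j : Fin n} (hij : i ≠ j) {p : MvPolynomial (Fin n) K} (hp : p ∈ supported K {i, j}ᶜ) :
    (fun x => eval x p) ∈ shearModule hΓ (Pi.single j 1) := by
  let P : ((Fin n → K) → K) → Prop := fun f => f ∈ shearModule hΓ (Pi.single j 1) ∧
    ∀ x (c : K), f (x + c • Pi.single i 1) = f x
  -- Stated for multiplication by p, so that products in the induction become compositions.
  have key : ∀ f, P f → P (fun x => eval x p * f x) := by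
    rw [supported_eq_adjoin_X] at hp
    induction hp using Algebra.adjoin_induction with
    | mem q hq =>
      obtain ⟨m, hm, rfl⟩ := hq
      simp only [Set.mem_compl_iff, Set.mem_insert_iff, Set.mem_singleton_iff, not_or] at hm
      intro f hf
      simp only [eval_X]
      exact ⟨coord_mul_mem_shearModule hsq hij hm.1 hm.2 hf.1 hf.2,
        fun x c => by simp [hf.2, hm.1]⟩
    | algebraMap r =>
      intro f hf
      simp only [algebraMap_eq, eval_C]
      exact ⟨(shearModule hΓ _).smul_mem r hf.1, fun x c => congrArg (r * ·) (hf.2 x c)⟩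
    | add q r _ _ hq hr =>
      intro f hf
      simp only [map_add, add_mul]
      exact ⟨(shearModule hΓ _).add_mem (hq f hf).1 (hr f hf).1,
        fun x c => congrArg₂ (· + ·) ((hq f hf).2 x c) ((hr f hf).2 x c)⟩
    | mul q r _ _ hq hr =>
      intro f hf
      simp only [map_mul, mul_assoc]
      exact hq _ (hr f hf)
  simpa using (key (fun _ => 1) ⟨const_mem_shearModule 1, fun _ _ => rfl⟩).1

/-- n ≥ 3 supplies a third coordinate m. Start from x_m^(a+b) q, free of x_i and x_j, and substitute
x_m ↦ x_m + c x_i: the coefficient of c^b is x_m^a x_i^b q times a nonzero binomial. -/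
theorem eval_mem_shearModule [CharZero K] (hn : 3 ≤ n)
    (hsq : ∀ i j : Fin n, i ≠ j → (fun x => x i ^ 2) ∈ shearModule hΓ (Pi.single j 1))
    {j : Fin n} {p : MvPolynomial (Fin n) K} (hp : p ∈ supported K {j}ᶜ) :
    (fun x => eval x p) ∈ shearModule hΓ (Pi.single j 1) := by
  obtain ⟨i, hij⟩ : ∃ i, i ≠ j := by
    have : Nontrivial (Fin n) := Fin.nontrivial_iff_two_le.2 (by omega)
    exact exists_ne j
  obtain ⟨m, hm⟩ : ∃ m, m ∉ ({i, j} : Finset (Fin n)) := by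
    by_contra! hc
    have h1 : (Finset.univ : Finset (Fin n)).card ≤ ({i, j} : Finset (Fin n)).card :=
      Finset.card_le_card fun x _ => hc x
    have h2 := Finset.card_le_two (a := i) (b := j)
    simp only [Finset.card_univ, Fintype.card_fin] at h1
    omega
  simp only [Finset.mem_insert, Finset.mem_singleton, not_or] at hm
  obtain ⟨hmi, hmj⟩ : m ≠ i ∧ m ≠ j := hm
  -- products of powers of two coordinates with polynomials in the others
  have key : ∀ (a b : ℕ) (q : MvPolynomial (Fin n) K), q ∈ supported K {i, j, m}ᶜ →
      (fun x => x m ^ a * x i ^ b * eval x q) ∈ shearModule hΓ (Pi.single j 1) := by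
    intro a b q hq
    have h1 : (fun x => eval x (X m ^ (a + b) * q)) ∈ shearModule hΓ (Pi.single j 1) := by
      refine eval_mem_shearModule_of_free hsq hij ((supported K _).mul_mem
        ((supported K _).pow_mem (X_mem_supported.2 (by simp [hmi, hmj])) _)
        (supported_mono ?_ hq))
      intro k
      simp
      tauto
    let P : Polynomial ((Fin n → K) → K) := ∑ k ∈ Finset.range (a + b + 1), Polynomial.monomial k
      (fun x => x i ^ k * x m ^ (a + b - k) * ((a + b).choose k : K) * eval x q)
    have h2 := mem_of_infinite_eval_mem (shearModule hΓ (Pi.single j 1)) P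
      Set.infinite_univ (fun c _ => by
        refine mem_of_forall_eq (comp_coordTransvection_mem_shearModule hmi.symm hij c h1)
          fun x => ?_
        have : eval (x + (c * x i) • Pi.single m 1) q = eval x q :=
          eval_eq_of_mem_supported hq fun k hk => by
            simp only [Set.mem_compl_iff, Set.mem_insert_iff, Set.mem_singleton_iff, not_or] at hk
            simp [hk.2.2]
        simp only [P, Polynomial.eval_finsetSum, Polynomial.eval_monomial, Finset.sum_apply,
          map_mul, map_pow, eval_X, this]
        simp only [Pi.add_apply, Pi.smul_apply, Pi.single_eq_same, smul_eq_mul, mul_one,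
          Pi.mul_apply, Pi.pow_apply]
        rw [add_comm (x m), add_pow, Finset.sum_mul]
        refine Finset.sum_congr rfl fun k _ => ?_
        ring) b
    simp only [P, Polynomial.finsetSum_coeff, Polynomial.coeff_monomial] at h2
    rw [Finset.sum_ite_eq', if_pos (Finset.mem_range.2 (by omega))] at h2
    have hch : ((a + b).choose b : K) ≠ 0 :=
      Nat.cast_ne_zero.2 (Nat.choose_pos (Nat.le_add_left _ _)).ne'
    refine mem_of_forall_eq ((shearModule hΓ _).smul_mem ((a + b).choose b : K)⁻¹ h2) fun x => ?_
    simp only [Pi.smul_apply, smul_eq_mul, Nat.add_sub_cancel]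
    field_simp
  simp only [MvPolynomial.eval_eq']
  have h1 := Submodule.sum_mem (shearModule hΓ (Pi.single j 1)) (t := p.support)
    (f := fun d x => p.coeff d * ∏ k, x k ^ d k) fun d hd => by
      have hdj : d j = 0 := by
        by_contra h0
        have : j ∈ p.vars := mem_vars_iff_mem_support j |>.2 ⟨d, hd, by simpa using h0⟩
        simpa using mem_supported.1 hp this
      have h2 := key (d m) (d i) (∏ k ∈ Finset.univ.erase m |>.erase i, X k ^ d k)
        (Subalgebra.prod_mem _ fun k hk => by
          rcases eq_or_ne k j with rfl | hkj
          · rw [hdj, pow_zero]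
            exact Subalgebra.one_mem _
          · simp only [Finset.mem_erase] at hk
            exact Subalgebra.pow_mem _ (X_mem_supported.2 (by simp [hk.1, hk.2.1, hkj])) _)
      refine mem_of_forall_eq ((shearModule hΓ _).smul_mem (p.coeff d) h2) fun x => ?_
      rw [← Finset.mul_prod_erase Finset.univ _ (Finset.mem_univ m),
        ← Finset.mul_prod_erase _ _ (Finset.mem_erase.2 ⟨hmi.symm, Finset.mem_univ i⟩)]
      simp only [Pi.smul_apply, smul_eq_mul, map_prod, map_pow, eval_X]
      ring
  refine mem_of_forall_eq h1 fun x => ?_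
  rw [Finset.sum_apply]

/-- Triangular maps of affine `n`-space. -/
def IsTriMap (h : (Fin n → K) → (Fin n → K)) : Prop :=
  ∀ i, ∃ (u : Kˣ) (P : MvPolynomial (Fin n) K), P ∈ supported K (Set.Iio i) ∧
    ∀ x, h x i = u * x i + eval x P

/-- Induction on the number of leading coordinates that h may move: a shear and a dilation, composed
on the right, clear the last of them and keep h triangular. -/
theorem IsTriMap.mem_of_shears
    (hS : ∀ (j : Fin n) (p : MvPolynomial (Fin n) K), p ∈ supported K {j}ᶜ →
      (fun x => eval x p) ∈ shearModule hΓ (Pi.single j 1))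
    {h : Equiv.Perm (Fin n → K)} (hh : IsTriMap h) : h ∈ Γ := by
  have key : ∀ k ≤ n, ∀ h : Equiv.Perm (Fin n → K), IsTriMap h →
      (∀ i : Fin n, k ≤ i → ∀ x, h x i = x i) → h ∈ Γ := by
    intro k
    induction k with
    | zero =>
      intro _ h _ hid
      have : h = 1 := Equiv.ext fun x => funext fun i => hid i (Nat.zero_le _) x
      rw [this]
      exact one_mem _
    | succ k ih =>
      intro hk h ht hid
      let j : Fin n := ⟨k, hk⟩
      obtain ⟨u, P, hP, hu⟩ := ht j
      have hPj : P ∈ supported K {j}ᶜ := supported_mono (fun i hi => ne_of_lt hi) hP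
      obtain ⟨-, hPinv, -⟩ := hS j P hPj
      obtain ⟨-, -, g, hg, hgx⟩ := (shearModule hΓ _).smul_mem (-(u : K)⁻¹) (hS j P hPj)
      let D : Equiv.Perm (Fin n → K) :=
        ⟨fun x => x + (((u : K)⁻¹ - 1) * x j) • Pi.single j 1,
          fun x => x + (((u : K) - 1) * x j) • Pi.single j 1,
          fun x => by
            dsimp only
            rw [add_assoc, ← add_smul]
            simp
            field_simp
            ring,
          fun x => by
            dsimp only
            rw [add_assoc, ← add_smul]
            simp
            field_simp
            ring⟩
      have hD : IsAffMap D := ⟨LinearMap.id +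
        (((u : K)⁻¹ - 1) • LinearMap.proj j).smulRight (Pi.single j 1), 0, fun x => by simp [D]⟩
      have hDmem := hΓ.aff _ hD
      have hDne : ∀ x i, i ≠ j → D x i = x i := fun x i hi => by simp [D, hi]
      have hgne : ∀ x i, i ≠ j → g x i = x i := fun x i hi => by simp [hgx, hi]
      have hcoord : ∀ x, (h * g * D) x j = x j := by
        intro x
        have h1 : eval (g (D x)) P = eval (D x) P :=
          eval_eq_of_mem_supported hPj fun i hi => hgne _ i hi
        simp only [Equiv.Perm.mul_apply]
        rw [hu, h1, hgx]
        simp [D]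
        field_simp
        ring
      have hmem : h * g * D ∈ Γ := by
        refine ih (by omega) _ (fun i => ?_) fun i hi x => ?_
        · rcases eq_or_ne i j with rfl | hij
          · exact ⟨1, 0, Subalgebra.zero_mem _, fun x => by rw [hcoord]; simp⟩
          · rcases lt_or_gt_of_ne hij with hlt | hgt
            · obtain ⟨u', P', hP', hu'⟩ := ht i
              refine ⟨u', P', hP', fun x => ?_⟩
              simp only [Equiv.Perm.mul_apply]
              rw [hu', hgne _ _ hij, hDne _ _ hij]
              congr 1
              refine eval_eq_of_mem_supported hP' fun m hm => ?_
              have hmj : m ≠ j := ne_of_lt (lt_trans hm hlt)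
              rw [hgne _ _ hmj, hDne _ _ hmj]
            · refine ⟨1, 0, Subalgebra.zero_mem _, fun x => ?_⟩
              simp only [Equiv.Perm.mul_apply]
              rw [hid i hgt, hgne _ _ hij, hDne _ _ hij]
              simp
        · rcases eq_or_ne i j with rfl | hij
          · exact hcoord x
          · simp only [Equiv.Perm.mul_apply]
            have : (i : ℕ) ≠ k := fun h => hij (Fin.ext h)
            rw [hid i (by omega), hgne _ _ hij, hDne _ _ hij]
      have := mul_mem (mul_mem hmem (inv_mem hDmem)) (inv_mem hg)
      rwa [mul_inv_cancel_right, mul_inv_cancel_right] at this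
  exact key n le_rfl h hh fun i hi => absurd i.2 (by omega)

/-- A group of polynomial automorphisms containing the affine ones which is not rigid contains
all triangular automorphisms. -/
theorem IsTriMap.mem_of_not_isRigid [CharZero K] (hn : 3 ≤ n) (hΓ : IsOverAffine Γ)
    (hR : ¬ IsRigid Γ) {h : Equiv.Perm (Fin n → K)} (hh : IsTriMap h) : h ∈ Γ := by
  obtain ⟨w, hw, f, hf, hna⟩ := exists_not_isAffFun_mem_shearModule hΓ hR
  obtain ⟨l, d, hd, hlw, hsq⟩ := sq_mem_shearModule hf hna
  have hl : l ≠ 0 := by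
    rintro rfl
    simp at hd
  exact hh.mem_of_shears fun j p hp => eval_mem_shearModule hn
    (fun i j hij => sq_coord_mem_shearModule hw hl hlw hsq hij) hp

end PolyMap

/-! ### Iterated commutators with a translation -/

namespace PolyMap

variable {K : Type*} [Field K] {n : ℕ}

/-- The commutator of `g` and `t`. -/
def commWith {G : Type*} [Group G] (t g : G) : G := g * t * g⁻¹ * t⁻¹

theorem conj_iterate_commWith {G : Type*} [Group G] (χ t g : G) (j : ℕ) :
    χ * (commWith t)^[j] g * χ⁻¹ = (commWith (χ * t * χ⁻¹))^[j] (χ * g * χ⁻¹) := by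
  induction j with
  | zero => rfl
  | succ j ih =>
    rw [Function.iterate_succ_apply', Function.iterate_succ_apply', ← ih]
    simp only [commWith]
    group

theorem iterate_commWith_mem {G : Type*} [Group G] {H : Subgroup G} {t g : G} (ht : t ∈ H)
    (hg : g ∈ H) (j : ℕ) : (commWith t)^[j] g ∈ H := by
  induction j with
  | zero => exact hg
  | succ j ih =>
    rw [Function.iterate_succ_apply']
    exact mul_mem (mul_mem (mul_mem ih ht) (inv_mem ih)) (inv_mem ht)

/-- Unitriangular maps which are trivial on the first `k` coordinates. -/
def IsUnitriangular (k : ℕ) (h : (Fin n → K) → (Fin n → K)) : Prop :=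
  (∀ i x y, (∀ m < i, x m = y m) → h x i - x i = h y i - y i) ∧
    ∀ i : Fin n, (i : ℕ) < k → ∀ x, h x i = x i

theorem inv_agree_of_agree {h : Equiv.Perm (Fin n → K)} {u : Fin n → K} (hu : ∀ i, u i ≠ 0)
    (hh : ∀ i x y, (∀ m < i, x m = y m) → h x i - u i * x i = h y i - u i * y i)
    {i : Fin n} {y z : Fin n → K} (hyz : ∀ m < i, y m = z m) :
    ∀ m < i, h⁻¹ y m = h⁻¹ z m := by
  intro m
  induction m using WellFoundedLT.induction with
  | _ m ih =>
    intro hm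
    have h1 := hh m (h⁻¹ y) (h⁻¹ z) fun k hk => ih k hk (hk.trans hm)
    rw [perm_apply_inv_self, perm_apply_inv_self, hyz m hm] at h1
    exact mul_left_cancel₀ (hu m) (sub_right_injective h1)

theorem commWith_addRight_apply (h : Equiv.Perm (Fin n → K)) (w z : Fin n → K) :
    commWith (Equiv.addRight w) h z = h (h⁻¹ (z - w) + w) := by
  simp only [commWith, Equiv.Perm.mul_apply]
  have : (Equiv.addRight w)⁻¹ z = z - w := by
    rw [Equiv.Perm.inv_eq_iff_eq]
    simp
  rw [this]
  rfl

/-- The diagonal coefficients u_i cancel in the commutator. -/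
theorem isUnitriangular_commWith {h : Equiv.Perm (Fin n → K)} {u : Fin n → K}
    (hu : ∀ i, u i ≠ 0)
    (hh : ∀ i x y, (∀ m < i, x m = y m) → h x i - u i * x i = h y i - u i * y i)
    (w : Fin n → K) : IsUnitriangular 0 (commWith (Equiv.addRight w) h : Equiv.Perm (Fin n → K)) := by
  refine ⟨fun i y z hyz => ?_, fun i hi => absurd hi (Nat.not_lt_zero _)⟩
  rw [commWith_addRight_apply, commWith_addRight_apply]
  have h1 := inv_agree_of_agree hu hh (i := i) (y := y - w) (z := z - w)
    fun m hm => by simp [hyz m hm]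
  have h2 := hh i (h⁻¹ (y - w)) (h⁻¹ (z - w)) h1
  have h3 := hh i (h⁻¹ (y - w) + w) (h⁻¹ (z - w) + w) fun m hm => by
    rw [Pi.add_apply, Pi.add_apply, h1 m hm]
  simp only [perm_apply_inv_self, Pi.sub_apply, Pi.add_apply] at h2 h3
  linear_combination h3 - h2

theorem IsUnitriangular.commWith {k : ℕ} {h : Equiv.Perm (Fin n → K)}
    (hh : IsUnitriangular k h) (w : Fin n → K) :
    IsUnitriangular k (PolyMap.commWith (Equiv.addRight w) h : Equiv.Perm (Fin n → K)) := by
  refine ⟨(isUnitriangular_commWith (u := fun _ => 1) (fun _ => one_ne_zero)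
    (by simpa using hh.1) w).1, fun i hi z => ?_⟩
  rw [commWith_addRight_apply, hh.2 i hi, Pi.add_apply, ← hh.2 i hi (h⁻¹ (z - w)),
    perm_apply_inv_self]
  simp

/-- All coordinates before k are fixed, so on coordinate k the commutator acts as a difference
operator, up to a shift by w. Iterating it kills a polynomial. -/
theorem IsUnitriangular.commWith_apply {k : Fin n} {h : Equiv.Perm (Fin n → K)}
    (hh : IsUnitriangular k h) (w z : Fin n → K) :
    PolyMap.commWith (Equiv.addRight w) h (z + w) k - (z + w) k =
      fwdDiff w (fun x => h x k - x k) z := by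
  rw [commWith_addRight_apply, add_sub_cancel_right, fwdDiff]
  have h1 : ∀ m < k, h⁻¹ z m = z m := fun m hm => by
    rw [← hh.2 m hm (h⁻¹ z), perm_apply_inv_self]
  have h2 := hh.1 k (h⁻¹ z) z h1
  have h3 := hh.1 k (h⁻¹ z + w) (z + w) fun m hm => by
    rw [Pi.add_apply, Pi.add_apply, h1 m hm]
  rw [perm_apply_inv_self] at h2
  simp only [Pi.add_apply] at h3 ⊢
  linear_combination h3 - h2

theorem IsUnitriangular.exists_iterate {k : Fin n} {h : Equiv.Perm (Fin n → K)}
    (hh : IsUnitriangular k h) (hp : IsPolyFun fun x => h x k) (w : Fin n → K) :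
    ∃ j, IsUnitriangular (k + 1) ((PolyMap.commWith (Equiv.addRight w))^[j] h) := by
  have hU : ∀ j, IsUnitriangular k ((PolyMap.commWith (Equiv.addRight w))^[j] h) := by
    intro j
    induction j with
    | zero => exact hh
    | succ j ih =>
      rw [Function.iterate_succ_apply']
      exact ih.commWith w
  have hD : ∀ j z, (PolyMap.commWith (Equiv.addRight w))^[j] h (z + j • w) k - (z + j • w) k =
      (fwdDiff w)^[j] (fun x => h x k - x k) z := by
    intro j
    induction j with
    | zero => intro z; simp
    | succ j ih =>
      intro z
      rw [Function.iterate_succ_apply', Function.iterate_succ_apply', succ_nsmul, ← add_assoc,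
        (hU j).commWith_apply, fwdDiff, fwdDiff, ← ih, ← ih, add_right_comm z w]
  obtain ⟨j, hj⟩ := (hp.sub (IsPolyFun.coord k)).iterate_fwdDiff_eq_zero w
  refine ⟨j, (hU j).1, fun i hi x => ?_⟩
  rcases Nat.lt_succ_iff_lt_or_eq.1 hi with hlt | heq
  · exact (hU j).2 i hlt x
  · obtain rfl : i = k := Fin.ext heq
    have := hD j (x - j • w)
    rw [hj, sub_add_cancel] at this
    exact sub_eq_zero.1 this

/-- Iterated commutators of a triangular automorphism with a translation terminate. -/
theorem IsTriMap.exists_iterate_commWith_eq_one {Λ : Subgroup (Equiv.Perm (Fin n → K))}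
    (hΛ : IsOverAffine Λ) {τ : Equiv.Perm (Fin n → K)} (hτΛ : τ ∈ Λ) (hτ : IsTriMap τ)
    (w : Fin n → K) : ∃ j, (commWith (Equiv.addRight w))^[j] τ = 1 := by
  have hw : Equiv.addRight w ∈ Λ := hΛ.aff _ (IsAffMap.translation w)
  have key : ∀ k ≤ n, ∃ j, IsUnitriangular k ((commWith (Equiv.addRight w))^[j] τ) := by
    intro k
    induction k with
    | zero =>
      intro _
      choose u P hP hu using hτ
      refine ⟨1, isUnitriangular_commWith (u := fun i => (u i : K)) (fun i => (u i).ne_zero)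
        (fun i x y hxy => ?_) w⟩
      rw [hu, hu, eval_eq_of_mem_supported (hP i) hxy]
      ring
    | succ k ih =>
      intro hk
      obtain ⟨j, hj⟩ := ih (by omega)
      obtain ⟨j', hj'⟩ := IsUnitriangular.exists_iterate (k := ⟨k, hk⟩) hj
        (hΛ.poly _ (iterate_commWith_mem hw hτΛ j) _) w
      exact ⟨j' + j, by rw [Function.iterate_add_apply]; exact hj'⟩
  obtain ⟨j, hj⟩ := key n le_rfl
  exact ⟨j, Equiv.ext fun x => funext fun i => hj.2 i i.2 x⟩

/-- χ need not lie in Γ: it only transports the termination of commutators from the triangular map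
to g. Rigidity then propagates affineness back from the identity to g. -/
theorem isAffMap_or_not_isRigid [CharZero K] {Γ Λ : Subgroup (Equiv.Perm (Fin n → K))}
    (hΓ : IsOverAffine Γ) (hΛ : IsOverAffine Λ) {g χ : Equiv.Perm (Fin n → K)} (hg : g ∈ Γ)
    {v w : Fin n → K} (hv : v ≠ 0) (hχ : χ * Equiv.addRight v * χ⁻¹ = Equiv.addRight w)
    (hτΛ : χ * g * χ⁻¹ ∈ Λ) (hτ : IsTriMap (χ * g * χ⁻¹ : Equiv.Perm (Fin n → K))) :
    IsAffMap g ∨ ¬ IsRigid Γ := by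
  classical
  by_contra! hcon
  obtain ⟨hna, hR⟩ := hcon
  have hvΓ : Equiv.addRight v ∈ Γ := hΓ.aff _ (IsAffMap.translation v)
  have hall : ∀ j, ¬ IsAffMap ((commWith (Equiv.addRight v))^[j] g) := by
    intro j
    induction j with
    | zero => exact hna
    | succ j ih =>
      intro haff
      apply ih
      refine hR.isAffMap_of_conj_translation hΓ (iterate_commWith_mem hvΓ hg j) hv ?_
      rw [Function.iterate_succ_apply'] at haff
      have h1 := haff.comp (IsAffMap.translation v)
      simp only [← Equiv.Perm.mul_apply, commWith, inv_mul_cancel_right] at h1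
      exact h1
  obtain ⟨j, hj⟩ := hτ.exists_iterate_commWith_eq_one hΛ hτΛ w
  rw [← hχ, ← conj_iterate_commWith] at hj
  have h1 : (commWith (Equiv.addRight v))^[j] g = 1 := by
    rw [← conj_eq_one_iff (a := χ), hj]
  exact hall j (h1 ▸ ⟨LinearMap.id, 0, fun x => by simp⟩)

end PolyMap

/-! ### Automorphisms as permutations of points -/

namespace PolyAut

open PolyMap

variable {K : Type*} [Field K] {n : ℕ}

theorem eval_act (x : Fin n → K) (P : MvPolynomial (Fin n) K) (φ : PolyAut K n) :
    eval x (act P φ) = eval (fun i => eval x (component φ i)) P := by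
  have : (aeval x).comp (φ.unop : MvPolynomial (Fin n) K →ₐ[K] MvPolynomial (Fin n) K) =
      aeval (fun i => eval x (component φ i)) :=
    MvPolynomial.algHom_ext fun i => by simp [component, act, aeval_eq_eval]
  have h := DFunLike.congr_fun this P
  simpa [act, aeval_eq_eval] using h

theorem ext_component {φ ψ : PolyAut K n} (h : ∀ i, component φ i = component ψ i) : φ = ψ := by
  apply MulOpposite.unop_injective
  apply AlgEquiv.coe_toAlgHom_injective
  exact MvPolynomial.algHom_ext h

/-- The action of polynomial automorphisms on the points of affine space. -/
noncomputable def toPerm (K : Type*) [Field K] (n : ℕ) :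
    PolyAut K n →* Equiv.Perm (Fin n → K) :=
  MonoidHom.toHomPerm
    { toFun := fun φ x i => eval x (component φ i)
      map_one' := by
        funext x i
        change eval x (X i) = x i
        simp
      map_mul' := fun φ ψ => by
        funext x i
        change eval x (act (act (X i) φ) ψ) = _
        rw [eval_act]
        rfl }

theorem toPerm_apply (φ : PolyAut K n) (x : Fin n → K) (i : Fin n) :
    toPerm K n φ x i = eval x (component φ i) := rfl

theorem toPerm_injective [Infinite K] : Function.Injective (toPerm K n) := fun φ ψ h =>
  ext_component fun i => MvPolynomial.funext fun x => by
    rw [← toPerm_apply, ← toPerm_apply, h]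

theorem exists_toPerm_eq [Infinite K] {h : Equiv.Perm (Fin n → K)}
    (h1 : ∀ i, IsPolyFun fun x => h x i)
    (h2 : ∀ i, IsPolyFun fun x => (h⁻¹ : Equiv.Perm (Fin n → K)) x i) :
    ∃ φ : PolyAut K n, toPerm K n φ = h := by
  choose p hp using h1
  choose q hq using h2
  have key : ∀ (p q : Fin n → MvPolynomial (Fin n) K) (h : Equiv.Perm (Fin n → K)),
      (∀ i x, h x i = eval x (p i)) → (∀ i x, h⁻¹ x i = eval x (q i)) →
      (aeval p : MvPolynomial (Fin n) K →ₐ[K] _).comp (aeval q) = AlgHom.id K _ := by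
    intro p q h hp hq
    refine MvPolynomial.algHom_ext fun i => MvPolynomial.funext fun x => ?_
    have h1 : (aeval x).comp (aeval p : MvPolynomial (Fin n) K →ₐ[K] _) = aeval (h x) :=
      MvPolynomial.algHom_ext fun k => by simp [hp, aeval_eq_eval]
    have h2 := DFunLike.congr_fun h1 (q i)
    simp only [AlgHom.comp_apply, aeval_eq_eval] at h2
    simp only [AlgHom.comp_apply, aeval_X, AlgHom.id_apply, eval_X]
    rw [h2, ← hq, perm_inv_apply_self]
  refine ⟨MulOpposite.op (AlgEquiv.ofAlgHom (aeval p) (aeval q) (key p q h hp hq)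
    (key q p h⁻¹ hq (by simpa using hp))), Equiv.ext fun x => funext fun i => ?_⟩
  refine Eq.trans ?_ (hp i x).symm
  rw [toPerm_apply]
  simp [component, act]

theorem IsAffine.isAffMap {φ : PolyAut K n} (h : IsAffine φ) : IsAffMap (toPerm K n φ) :=
  isAffMap_of_isAffFun fun i => isAffFun_eval_of_totalDegree_le_one (h i).le

theorem isAffine_of_isAffMap [Infinite K] {φ : PolyAut K n} (h : IsAffMap (toPerm K n φ)) :
    IsAffine φ := by
  obtain ⟨A, b, hA⟩ := h
  intro i
  have h1 : component φ i =
      (∑ k, C (A (Pi.single k 1) i) * X k) + C (b i) := MvPolynomial.funext fun x => by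
    rw [← toPerm_apply, hA, Pi.add_apply, map_add, eval_C, map_sum]
    congr 1
    rw [LinearMap.pi_apply_eq_sum_univ A x, Finset.sum_apply]
    refine Finset.sum_congr rfl fun k _ => ?_
    have : (fun j => if k = j then (1 : K) else 0) = Pi.single k 1 := by
      funext j
      simp [Pi.single_apply, eq_comm]
    simp [this, mul_comm]
  have h2 : (component φ i).totalDegree ≤ 1 := by
    rw [h1]
    refine (totalDegree_add _ _).trans (max_le ?_ (by simp))
    refine totalDegree_finsetSum_le fun k _ => ?_
    refine (totalDegree_mul _ _).trans ?_
    simp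
  -- A constant component would make X i constant, by injectivity of φ.
  have h3 : (component φ i).totalDegree ≠ 0 := by
    intro h0
    rw [totalDegree_eq_zero_iff_eq_C] at h0
    have h4 : (X i : MvPolynomial (Fin n) K) = C (coeff 0 (component φ i)) := by
      apply φ.unop.injective
      change component φ i = _
      rw [← algebraMap_eq, AlgEquiv.commutes]
      exact h0
    have := congrArg totalDegree h4
    simp at this
  omega

theorem IsTriangular.isTriMap {φ : PolyAut K n} (h : IsTriangular φ) :
    IsTriMap (toPerm K n φ) := fun i => by
  obtain ⟨u, P, hP, hu⟩ := h i
  exact ⟨u, P, hP, fun x => by rw [toPerm_apply, hu]; simp⟩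

theorem isOverAffine_map [Infinite K] {G : Subgroup (PolyAut K n)} (hG : ∀ φ, IsAffine φ → φ ∈ G) :
    IsOverAffine (G.map (toPerm K n)) where
  poly := by
    rintro _ ⟨φ, -, rfl⟩ i
    exact ⟨component φ i, fun x => rfl⟩
  aff := fun h hh => by
    obtain ⟨φ, rfl⟩ := exists_toPerm_eq hh.isPolyFun hh.symm.isPolyFun
    exact ⟨φ, hG _ (isAffine_of_isAffMap hh), rfl⟩

theorem toPerm_translation (r : Fin n) (c : K) :
    toPerm K n (translation r c) = Equiv.addRight (c • Pi.single r 1) := by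
  refine Equiv.ext fun x => funext fun i => ?_
  have : component (translation r c) i = if i = r then X i + C c else X i := by
    change translationHom r c (X i) = _
    simp [translationHom]
  rw [toPerm_apply, this]
  rcases eq_or_ne i r with rfl | hi
  · simp
  · simp [hi]

end PolyAut

/-! ### Conclusion -/

open PolyAut PolyMap in
theorem mainTheorem4 {K : Type*} [Field K] [CharZero K] (n : ℕ) (hn : 3 ≤ n)
    (ψ τ α : PolyAut K n)
    (hψ : ψ ∈ PolyAut.parabolic K n (le_trans (by norm_num) hn))
    (hτ : PolyAut.IsTriangular τ) (hα : PolyAut.IsLinear α) :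
    PolyAut.IsAffine (ψ⁻¹ * α⁻¹ * τ * α * ψ) ∨
      PolyAut.IsCoTame (ψ⁻¹ * α⁻¹ * τ * α * ψ) := by
  set φ := ψ⁻¹ * α⁻¹ * τ * α * ψ with hφ
  set r : Fin n := ⟨n - 1, by omega⟩
  set G : Subgroup (PolyAut K n) := Subgroup.closure ({φ} ∪ {α | IsAffine α}) with hG
  have hφG : φ ∈ G := Subgroup.subset_closure (Or.inl rfl)
  have haffG : ∀ β, IsAffine β → β ∈ G := fun β hβ => Subgroup.subset_closure (Or.inr hβ)
  have hΓ : IsOverAffine (G.map (toPerm K n)) := isOverAffine_map haffG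
  have hΛ : IsOverAffine ((⊤ : Subgroup (PolyAut K n)).map (toPerm K n)) :=
    isOverAffine_map fun _ _ => Subgroup.mem_top _
  have hconj : α * ψ * φ * (α * ψ)⁻¹ = τ := by
    rw [hφ]
    group
  -- Parabolicity of ψ gives a translation, and conjugation by α turns it into another one.
  obtain ⟨c, hc⟩ : ψ * translation r 1 * ψ⁻¹ ∈ translations K r :=
    (Subgroup.mem_normalizer_iff.1 hψ (translation r 1)).1 ⟨1, rfl⟩
  obtain ⟨A, b, hA⟩ := hα.1.isAffMap
  have hχ : toPerm K n (α * ψ) * Equiv.addRight (Pi.single r 1) * (toPerm K n (α * ψ))⁻¹ =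
      Equiv.addRight (A (c • Pi.single r 1)) := by
    have h1 := toPerm_translation r (1 : K)
    rw [one_smul] at h1
    rw [← h1, ← map_inv, ← map_mul, ← map_mul,
      show α * ψ * translation r 1 * (α * ψ)⁻¹ = α * (ψ * translation r 1 * ψ⁻¹) * α⁻¹ by group,
      hc, map_mul, map_mul, map_inv, toPerm_translation, mul_inv_eq_iff_eq_mul]
    refine Equiv.ext fun x => ?_
    simp only [Equiv.Perm.mul_apply, Equiv.coe_addRight, hA, map_add]
    abel
  have hτ' : toPerm K n (α * ψ) * toPerm K n φ * (toPerm K n (α * ψ))⁻¹ = toPerm K n τ := by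
    rw [← map_inv, ← map_mul, ← map_mul, hconj]
  rcases isAffMap_or_not_isRigid hΓ hΛ (Subgroup.mem_map_of_mem _ hφG)
    (v := Pi.single r 1) (by simp) hχ
    (hτ' ▸ Subgroup.mem_map_of_mem _ (Subgroup.mem_top _)) (hτ' ▸ hτ.isTriMap) with h | h
  · exact Or.inl (isAffine_of_isAffMap h)
  · right
    refine (Subgroup.closure_le _).2 ?_
    rintro θ (hθ | hθ)
    · exact haffG θ hθ
    · exact (Subgroup.mem_map_iff_mem toPerm_injective).1
        (IsTriMap.mem_of_not_isRigid hn hΓ h (IsTriangular.isTriMap hθ))
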